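/- **Lemma 2.1 (Equivalence).** Let $d\in\{2,3\}$, $\Omega\ge 0$, and let $x^\perp=(x_2,-x_1)$ if $d=2$, $x^\perp=(x_2,-x_1,0)$ if $d=3$. Let $f\in C^\infty(\mathbb R)$ with $f'>0$, and let $V\in C^\infty(\mathbb R^d;\mathbb R)$ (for example a harmonic potential $V(x)=\frac12\sum_j\omega_j^2x_j^2$). Let $a_{\rm in}\in C^\infty(\mathbb R^d;\mathbb C)$, and let $\Phi_{\rm in}\in C^\infty(\mathbb R^d;\mathbb R)$ be sub-quadratic, i.e. $\sup_x|\partial^\alpha\Phi_{\rm in}(x)|<\infty$ for all $|\alpha|\ge 2$. For $\tau\in(0,\infty]$ consider: * smooth solutions $(\rho,\mathbf v)$ on $[0,\tau)$ of the rotating hydrodynamic system $$\partial_t\rho+\nabla\cdot\big(\rho(\mathbf v-\Omega x^\perp)\big)=0,\qquad \partial_t\mathbf v+\nabla\Big(\tfrac12|\mathbf v|^2-\Omega x^\perp\cdot\mathbf v+V+f(\rho)\Big)=0,$$ $$\rho|_{t=0}=|a_{\rm in}|^2,\qquad \mathbf v|_{t=0}=\nabla\Phi_{\rm in},$$ meaning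 that $\rho\ge 0$ and $\mathbf v$ are real-valued, respectively $\mathbb R^d$-valued, functions of class $C^\infty$ on $[0,\tau)\times\mathbb R^d$, satisfying the equations for $0<t<\tau$, and that $\partial_x^\alpha\mathbf v$ is bounded on $[0,t_1]\times\mathbb R^d$ for all $t_1<\tau$ and $|\alpha|\ge1$; * smooth solutions $(a,\Phi)$ on $[0,\tau)$ of the limiting WKB system $$\partial_t\Phi+\tfrac12|\nabla\Phi|^2+V-\Omega x^\perp\cdot\nabla\Phi+f(|a|^2)=0,\qquad \partial_t a+\nabla\Phi\cdot\nabla a+\tfrac12a\,\Delta\Phi-\Omega x^\perp\cdot\nabla a=0,$$ $$a|_{t=0}=a_{\rm in},\qquad \Phi|_{t=0}=\Phi_{\rm in},$$ meaning that $a$ (complex-valued) and $\Phi$ (real-valued) are of class $C^\infty$ on $[0,\tau)\times\mathbb R^d$, satisfy the equations for $0<t<\tau$, and that $\partial_x^\alpha\Phi$ is bounded on $[0,t_1]\times\mathbb R^d$ for all $t_1<\tau$ and $|\alpha|\ge2$ (the phase stays sub-quadratic, locally uniformly in time). Let $T,T^*\in[0,\infty]$ be the suprema of those $\tau$ for which a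 smooth solution $(\rho,\mathbf v)$, respectively $(a,\Phi)$, on $[0,\tau)$ exists (the supremum being $0$ if there is none). Then $$T=T^*.$$ Moreover, for every $\tau\in(0,\infty]$ the identification $\rho=|a|^2$, $\mathbf v=\nabla\Phi$ is a one-to-one correspondence between the smooth solutions on $[0,\tau)$ of the two systems: if $(a,\Phi)$ is a smooth solution on $[0,\tau)$ of the WKB system, then $(|a|^2,\nabla\Phi)$ is one of the hydrodynamic system; and for every smooth solution $(\rho,\mathbf v)$ on $[0,\tau)$ of the hydrodynamic system there is exactly one smooth solution $(a,\Phi)$ on $[0,\tau)$ of the WKB system with $\rho=|a|^2$ and $\mathbf v=\nabla\Phi$. -/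

import Mathlib

open Set
open scoped ENNReal ContDiff Gradient Laplacian

noncomputable section

namespace Superfluid

/-- The Euclidean space `ℝ^d`. -/
abbrev Space (d : ℕ) : Type := EuclideanSpace ℝ (Fin d)

/-- The `d × d` matrix `J` whose only non-zero entries are `J₁₂ = 1` and `J₂₁ = -1`
(rows and columns are numbered from `0` in the code). -/
def perpMatrix (d : ℕ) : Matrix (Fin d) (Fin d) ℝ :=
  fun i j =>
    if i.val = 0 ∧ j.val = 1 then 1 else if i.val = 1 ∧ j.val = 0 then -1 else 0

/-- `x^⊥ = J x`, that is `(x₂, -x₁)` for `d = 2` and `(x₂, -x₁, 0)` for `d = 3`. -/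
def perp {d : ℕ} (x : Space d) : Space d :=
  WithLp.toLp 2 ((perpMatrix d).mulVec x.ofLp)

/-- The divergence `∑ᵢ ∂ᵢ Fᵢ` of a vector field on `ℝ^d`. -/
def divergence {d : ℕ} (F : Space d → Space d) (x : Space d) : ℝ :=
  ∑ i, (fderiv ℝ F x (EuclideanSpace.single i 1)) i

/-- A smooth function is sub-quadratic if all its derivatives of order at least two are
bounded on `ℝ^d`. -/
def SubQuadratic {d : ℕ} (g : Space d → ℝ) : Prop :=
  ContDiff ℝ ∞ g ∧ ∀ n : ℕ, 2 ≤ n → ∃ C : ℝ, ∀ x, ‖iteratedFDeriv ℝ n g x‖ ≤ C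

/-- The time interval `[0, τ)`, where `τ ∈ [0, ∞]`. -/
def lifespan (τ : ℝ≥0∞) : Set ℝ := {t : ℝ | 0 ≤ t ∧ ENNReal.ofReal t < τ}

/-- The spatial derivatives of order at least `k` of the time-dependent function `u` are bounded
on `[0, t₁] × ℝ^d` for every `t₁` in `[0, τ)`. -/
def BoundedDerivsFrom {d : ℕ} {F : Type*} [NormedAddCommGroup F] [NormedSpace ℝ F]
    (k : ℕ) (τ : ℝ≥0∞) (u : ℝ → Space d → F) : Prop :=
  ∀ t₁ ∈ lifespan τ, ∀ n : ℕ, k ≤ n →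
    ∃ C : ℝ, ∀ t ∈ Icc 0 t₁, ∀ x, ‖iteratedFDeriv ℝ n (u t) x‖ ≤ C

/-- `u` is of class `C^∞` on `[0, τ) × ℝ^d`, jointly in time and space and up to `t = 0`. -/
def SmoothOnLifespan {d : ℕ} {F : Type*} [NormedAddCommGroup F] [NormedSpace ℝ F]
    (τ : ℝ≥0∞) (u : ℝ → Space d → F) : Prop :=
  ContDiffOn ℝ ∞ (fun p : ℝ × Space d => u p.1 p.2) (lifespan τ ×ˢ univ)

/-- `(ρ, v)` is a smooth solution on `[0, τ)`, with `ρ ≥ 0` and initial data `(ρ₀, v₀)`, of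
`∂ₜ ρ + ∇ · (ρ (v - Ω x^⊥)) = 0`,
`∂ₜ v + ∇ (|v|²/2 - Ω x^⊥ · v + V + f(ρ)) = 0`.
The velocity is the gradient of a sub-quadratic phase, so its derivatives of order at least one
are bounded in space, locally uniformly in time. -/
structure IsHydroSolution {d : ℕ} (Ω : ℝ) (V : Space d → ℝ) (f : ℝ → ℝ)
    (ρ₀ : Space d → ℝ) (v₀ : Space d → Space d) (τ : ℝ≥0∞)
    (ρ : ℝ → Space d → ℝ) (v : ℝ → Space d → Space d) : Prop where
  smooth_density : SmoothOnLifespan τ ρ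
  smooth_velocity : SmoothOnLifespan τ v
  bounded_derivs : BoundedDerivsFrom 1 τ v
  nonneg : ∀ t ∈ lifespan τ, ∀ x, 0 ≤ ρ t x
  initial_density : ρ 0 = ρ₀
  initial_velocity : v 0 = v₀
  continuity_eq : ∀ t ∈ lifespan τ, 0 < t → ∀ x,
    deriv (fun s => ρ s x) t + divergence (fun y => ρ t y • (v t y - Ω • perp y)) x = 0
  momentum_eq : ∀ t ∈ lifespan τ, 0 < t → ∀ x,
    deriv (fun s => v s x) t
      + ∇ (fun y => ‖v t y‖ ^ 2 / 2 - Ω * inner ℝ (perp y) (v t y) + V y + f (ρ t y)) x = 0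

/-- `(a, Φ)` is a smooth solution on `[0, τ)`, with initial data `(a₀, Φ₀)`, of
`∂ₜ Φ + |∇Φ|²/2 + V - Ω x^⊥ · ∇Φ + f(|a|²) = 0`,
`∂ₜ a + ∇Φ · ∇a + a ΔΦ / 2 - Ω x^⊥ · ∇a = 0`,
whose phase is sub-quadratic, locally uniformly in time.
Here `w · ∇a` is the real directional derivative of the complex function `a` along `w`. -/
structure IsWKBSolution {d : ℕ} (Ω : ℝ) (V : Space d → ℝ) (f : ℝ → ℝ)
    (a₀ : Space d → ℂ) (Φ₀ : Space d → ℝ) (τ : ℝ≥0∞)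
    (a : ℝ → Space d → ℂ) (Φ : ℝ → Space d → ℝ) : Prop where
  smooth_amplitude : SmoothOnLifespan τ a
  smooth_phase : SmoothOnLifespan τ Φ
  bounded_derivs : BoundedDerivsFrom 2 τ Φ
  initial_amplitude : a 0 = a₀
  initial_phase : Φ 0 = Φ₀
  phase_eq : ∀ t ∈ lifespan τ, 0 < t → ∀ x,
    deriv (fun s => Φ s x) t + ‖∇ (Φ t) x‖ ^ 2 / 2 + V x
      - Ω * inner ℝ (perp x) (∇ (Φ t) x) + f (‖a t x‖ ^ 2) = 0
  amplitude_eq : ∀ t ∈ lifespan τ, 0 < t → ∀ x,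
    deriv (fun s => a s x) t + fderiv ℝ (a t) x (∇ (Φ t) x)
      + (1 / 2 : ℂ) * a t x * ((Laplacian.laplacian (Φ t) x : ℝ) : ℂ)
      - (Ω : ℂ) * fderiv ℝ (a t) x (perp x) = 0

/-- The maximal existence time in `[0, ∞]` of a smooth solution of the hydrodynamical system. -/
def hydroMaxTime {d : ℕ} (Ω : ℝ) (V : Space d → ℝ) (f : ℝ → ℝ)
    (ρ₀ : Space d → ℝ) (v₀ : Space d → Space d) : ℝ≥0∞ :=
  sSup {τ | 0 < τ ∧ ∃ ρ v, IsHydroSolution Ω V f ρ₀ v₀ τ ρ v}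

/-- The maximal existence time in `[0, ∞]` of a smooth solution of the limiting WKB system. -/
def wkbMaxTime {d : ℕ} (Ω : ℝ) (V : Space d → ℝ) (f : ℝ → ℝ)
    (a₀ : Space d → ℂ) (Φ₀ : Space d → ℝ) : ℝ≥0∞ :=
  sSup {τ | 0 < τ ∧ ∃ a Φ, IsWKBSolution Ω V f a₀ Φ₀ τ a Φ}

end Superfluid

end

/-! Once the velocity is known, everything else is linear. Write B for the Bernoulli function |v|²/2
- Ω x^⊥·v + V + f(ρ). The phase equation reads ∂ₜΦ = -B and the momentum equation is its gradient.
Hence a WKB solution gives the momentum equation by commuting ∂ₜ and ∇. Conversely, Φ := Φ₀ - ∫₀ᵗ B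
satisfies ∂ₜ(v - ∇Φ) = 0 with zero initial value, so v = ∇Φ; no separate irrotationality argument is
needed (`IsHydroSolution.exists_phase`).

Since x^⊥ is divergence free, the amplitude equation is a linear transport equation along v - Ωx^⊥
with zero-order coefficient div v / 2. Pairing it with 2a shows that |a|² solves the continuity
equation, whose coefficient is div v (`normSq_transport`). Given (ρ, v), the amplitude is obtained
by solving this linear equation from a₀. Uniqueness for transport equations (`transport_eq_zero`)
then yields ρ = |a|², and also the uniqueness of a; Φ is determined by its time derivative. Zeros of
a cause no trouble, because a is never recovered from ρ.

The analytic core is `exists_transport_solution`: smooth solutions on the whole of [0, τ), up to t =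
0. They come from the backward characteristic flow, which is global because the derivatives of v are
bounded and smooth by dependence of differential equations on parameters. The lifespan is preserved
in both directions, so the two suprema are taken over the same set. -/

noncomputable section

namespace Superfluid

open Filter Topology Function
open scoped NNReal

/-! ### Ordinary differential equations on [0, 1]: existence, Grönwall, uniformity near compact sets
-/

/-- Global existence on `[0, 1]` for an ordinary differential equation with a globally Lipschitz
right-hand side. -/
theorem exists_solution_of_lipschitzWith {E : Type*} [NormedAddCommGroup E] [NormedSpace ℝ E]
    [CompleteSpace E] {g : ℝ → E → E} {L : ℝ≥0}
    (hg : ContinuousOn (fun q : ℝ × E => g q.1 q.2) (Icc 0 1 ×ˢ univ))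
    (hL : ∀ s ∈ Icc (0 : ℝ) 1, LipschitzWith L (g s)) (z₀ : E) :
    ∃ u : ℝ → E, u 0 = z₀ ∧
      ∀ s ∈ Icc (0 : ℝ) 1, HasDerivWithinAt u (g s (u s)) (Icc 0 1) s := by
  -- Clamping time to [0, 1] makes the integrand continuous on all of ℝ, so the fundamental theorem
  -- of calculus applies at the endpoints too.
  let π : ℝ → Icc (0 : ℝ) 1 := projIcc 0 1 zero_le_one
  have hπ : Continuous π := continuous_projIcc
  -- Exponential weight: for the rescaled unknown w(s) = e^{-lam s} u(s), the Picard map has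
  -- Lipschitz constant at most L / lam ≤ 1/2 on all of [0, 1]. The summand 1 keeps `lam` positive
  -- when L = 0.
  let lam : ℝ := 2 * L + 1
  have hlam : 0 < lam := by positivity
  let G : C(Icc (0 : ℝ) 1, E) → ℝ → E :=
    fun w σ => g (π σ) (Real.exp (lam * σ) • w (π σ))
  have hG : ∀ w, Continuous (G w) := fun w => by
    have h1 : Continuous fun σ : ℝ => (((π σ : ℝ), Real.exp (lam * σ) • w (π σ)) : ℝ × E) := by
      fun_prop
    exact hg.comp_continuous h1 fun σ => ⟨(π σ).2, mem_univ _⟩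
  have hI : ∀ w, Continuous fun s : ℝ => ∫ σ in (0 : ℝ)..s, G w σ := fun w =>
    intervalIntegral.continuous_primitive (fun a b => (hG w).intervalIntegrable a b) 0
  let F : C(Icc (0 : ℝ) 1, E) → C(Icc (0 : ℝ) 1, E) := fun w =>
    ⟨fun s => Real.exp (-(lam * s)) • (z₀ + ∫ σ in (0 : ℝ)..s, G w σ), by
      have := (hI w).comp (continuous_subtype_val (p := fun x : ℝ => x ∈ Icc (0 : ℝ) 1))
      simp only [Function.comp_def] at this
      fun_prop⟩
  have hF : ContractingWith (1 / 2) F := by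
    refine ⟨by norm_num, LipschitzWith.of_dist_le_mul fun w w' => ?_⟩
    refine (ContinuousMap.dist_le (by positivity)).2 fun s => ?_
    have hs : (0 : ℝ) ≤ s := s.2.1
    have key : ‖(∫ σ in (0 : ℝ)..s, G w σ) - ∫ σ in (0 : ℝ)..s, G w' σ‖
        ≤ ∫ σ in (0 : ℝ)..s, L * dist w w' * Real.exp (lam * σ) := by
      rw [← intervalIntegral.integral_sub ((hG w).intervalIntegrable _ _)
        ((hG w').intervalIntegrable _ _)]
      refine intervalIntegral.norm_integral_le_of_norm_le hs (MeasureTheory.ae_of_all _ fun σ _ => ?_)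
        ((by fun_prop : Continuous fun σ : ℝ =>
          L * dist w w' * Real.exp (lam * σ)).intervalIntegrable _ _)
      have h1 := (hL (π σ) (π σ).2).dist_le_mul (Real.exp (lam * σ) • w (π σ))
        (Real.exp (lam * σ) • w' (π σ))
      rw [dist_smul₀, Real.norm_of_nonneg (Real.exp_pos _).le, dist_eq_norm] at h1
      refine h1.trans ?_
      have h2 := ContinuousMap.dist_apply_le_dist (f := w) (g := w') (π σ)
      have h3 := mul_le_mul_of_nonneg_left h2 (mul_nonneg L.2 (Real.exp_pos (lam * σ)).le)
      simp only [NNReal.val_eq_coe] at h3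
      linarith
    have hint : ∫ σ in (0 : ℝ)..s, L * dist w w' * Real.exp (lam * σ)
        = L * dist w w' * (lam⁻¹ * (Real.exp (lam * s) - 1)) := by
      rw [intervalIntegral.integral_const_mul,
        intervalIntegral.integral_comp_mul_left (fun x => Real.exp x) hlam.ne']
      simp
    rw [hint] at key
    change dist (Real.exp (-(lam * s)) • (z₀ + ∫ σ in (0 : ℝ)..s, G w σ))
      (Real.exp (-(lam * s)) • (z₀ + ∫ σ in (0 : ℝ)..s, G w' σ)) ≤ _
    rw [dist_smul₀, Real.norm_of_nonneg (Real.exp_pos _).le, dist_add_left, dist_eq_norm]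
    calc Real.exp (-(lam * s)) * _
        ≤ Real.exp (-(lam * s)) * (L * dist w w' * (lam⁻¹ * (Real.exp (lam * s) - 1))) := by
          gcongr
      _ = (L / lam) * dist w w' * (1 - Real.exp (-(lam * s))) := by
          rw [Real.exp_neg]; field_simp
      _ ≤ (L / lam) * dist w w' * 1 := by
          gcongr
          linarith [Real.exp_pos (-(lam * s))]
      _ ≤ ((1 / 2 : ℝ≥0) : ℝ) * dist w w' := by
          rw [mul_one]
          gcongr
          rw [div_le_iff₀ hlam]
          simp only [lam]
          push_cast
          linarith
  let w := hF.fixedPoint F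
  have hw : F w = w := hF.fixedPoint_isFixedPt
  refine ⟨fun s => z₀ + ∫ σ in (0 : ℝ)..s, G w σ, by simp, fun s hs => ?_⟩
  have h1 : HasDerivAt (fun s => z₀ + ∫ σ in (0 : ℝ)..s, G w σ) (G w s) s :=
    ((hG w).integral_hasStrictDerivAt 0 s).hasDerivAt.const_add z₀
  have h2 : π s = ⟨s, hs⟩ := projIcc_of_mem _ hs
  have h3 : w ⟨s, hs⟩ = Real.exp (-(lam * s)) • (z₀ + ∫ σ in (0 : ℝ)..s, G w σ) := by
    conv_lhs => rw [← hw]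
    rfl
  have h4 : G w s = g s (z₀ + ∫ σ in (0 : ℝ)..s, G w σ) := by
    simp only [G]
    rw [h2, h3, smul_smul, ← Real.exp_add, add_neg_cancel, Real.exp_zero, one_smul]
  rw [← h4]
  exact h1.hasDerivWithinAt

/-- Grönwall's inequality on `[0, 1]` for a function vanishing at `0`. -/
theorem norm_le_mul_exp_of_norm_deriv_le {E : Type*} [NormedAddCommGroup E] [NormedSpace ℝ E]
    {y y' : ℝ → E} {K ε : ℝ} (hK : 1 ≤ K) (hε : 0 ≤ ε)
    (hy : ∀ s ∈ Icc (0 : ℝ) 1, HasDerivWithinAt y (y' s) (Icc 0 1) s) (h0 : y 0 = 0)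
    (hb : ∀ s ∈ Icc (0 : ℝ) 1, ‖y' s‖ ≤ K * ‖y s‖ + ε) :
    ∀ s ∈ Icc (0 : ℝ) 1, ‖y s‖ ≤ ε * Real.exp K := by
  intro s hs
  have h := norm_le_gronwallBound_of_norm_deriv_right_le (f := y) (f' := y') (δ := 0) (K := K)
    (ε := ε) (a := 0) (b := 1) (fun s hs => (hy s hs).continuousWithinAt)
    (fun s hs => (hy s ⟨hs.1, hs.2.le⟩).mono_of_mem_nhdsWithin (Icc_mem_nhdsGE_of_mem hs))
    (by simp [h0]) (fun s hs => hb s ⟨hs.1, hs.2.le⟩) s hs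
  rw [gronwallBound_of_K_ne_0 (by linarith)] at h
  refine h.trans ?_
  simp only [zero_mul, sub_zero, zero_add]
  have h1 : Real.exp (K * s) - 1 ≤ Real.exp K := by
    have : Real.exp (K * s) ≤ Real.exp K := Real.exp_le_exp.2 (by nlinarith [hs.2])
    linarith
  have h2 : ε / K ≤ ε := div_le_self hε hK
  have h3 : 0 ≤ ε / K := by positivity
  have h4 : 0 ≤ Real.exp K := (Real.exp_pos K).le
  calc ε / K * (Real.exp (K * s) - 1) ≤ ε / K * Real.exp K := by gcongr
    _ ≤ ε * Real.exp K := by gcongr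

/-- A function continuous on `D` varies little near a compact subset of `D`, uniformly. -/
theorem exists_pos_forall_dist_lt_of_isCompact {A B : Type*} [PseudoMetricSpace A]
    [PseudoMetricSpace B] {h : A → B} {D K : Set A} (hh : ContinuousOn h D) (hK : IsCompact K)
    (hKD : K ⊆ D) {ε : ℝ} (hε : 0 < ε) :
    ∃ δ > 0, ∀ k ∈ K, ∀ y ∈ D, dist y k < δ → dist (h y) (h k) < ε := by
  -- Only K is compact, so uniformity is argued by sequences: pairs violating the bound at distance
  -- 1/(n+1) accumulate at one point of K, where continuity within D is contradicted.
  by_contra! hcon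
  let r : ℕ → ℝ := fun n => 1 / ((n : ℝ) + 1)
  have hr : ∀ n, 0 < r n := fun n => by positivity
  choose k hk y hy hyk hd using fun n => hcon (r n) (hr n)
  obtain ⟨a, ha, φ, hφ, hlim⟩ := hK.tendsto_subseq hk
  have hr0 : Tendsto (fun n => r (φ n)) atTop (𝓝 0) :=
    (tendsto_one_div_add_atTop_nhds_zero_nat (𝕜 := ℝ)).comp hφ.tendsto_atTop
  have hlim' : Tendsto (fun n => y (φ n)) atTop (𝓝 a) := by
    refine (tendsto_iff_of_dist ?_).1 hlim
    refine squeeze_zero (fun _ => dist_nonneg) (fun n => ?_) hr0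
    rw [dist_comm]
    exact (hyk _).le
  have hc := hh a (hKD ha)
  have h1 : Tendsto (fun n => h (k (φ n))) atTop (𝓝 (h a)) :=
    hc.tendsto.comp (tendsto_nhdsWithin_iff.2 ⟨hlim, Eventually.of_forall fun n => hKD (hk _)⟩)
  have h2 : Tendsto (fun n => h (y (φ n))) atTop (𝓝 (h a)) :=
    hc.tendsto.comp (tendsto_nhdsWithin_iff.2 ⟨hlim', Eventually.of_forall fun n => hy _⟩)
  have h3 := h2.dist h1
  rw [dist_self] at h3
  obtain ⟨n, hn⟩ := (h3.eventually (gt_mem_nhds hε)).exists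
  exact absurd hn (not_lt.2 (hd _))

/-! ### Smooth dependence of solutions on parameters -/

section ParametricODE

universe u

variable {X E : Type u} [NormedAddCommGroup X] [NormedSpace ℝ X] [NormedAddCommGroup E]
  [NormedSpace ℝ E] {P : Set X} {g : ℝ → X → E → E} {Z : ℝ → X → E}

set_option linter.unusedSectionVars false in
/-- The graph of a solution over `[0, 1]` is compact. -/
theorem isCompact_graph_solution {p : X}
    (hZ : ∀ s ∈ Icc (0 : ℝ) 1, HasDerivWithinAt (Z · p) (g s p (Z s p)) (Icc 0 1) s) :
    IsCompact ((fun s : ℝ => (s, p, Z s p)) '' Icc 0 1) := by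
  refine isCompact_Icc.image_of_continuousOn ?_
  have : ContinuousOn (fun s => Z s p) (Icc 0 1) := fun s hs => (hZ s hs).continuousWithinAt
  fun_prop

/-- Solutions of a parametric equation depend continuously on the parameter, uniformly in time. -/
theorem eventually_forall_norm_solution_sub_le {z₀ : E}
    (hg : ContinuousOn (fun q : ℝ × X × E => g q.1 q.2.1 q.2.2) (Icc 0 1 ×ˢ P ×ˢ univ))
    (hL : ∀ p ∈ P, ∃ K : ℝ≥0, ∀ᶠ q in 𝓝[P] p, ∀ s ∈ Icc (0 : ℝ) 1, LipschitzWith K (g s q))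
    (h0 : ∀ p ∈ P, Z 0 p = z₀)
    (hZ : ∀ p ∈ P, ∀ s ∈ Icc (0 : ℝ) 1,
      HasDerivWithinAt (Z · p) (g s p (Z s p)) (Icc 0 1) s)
    {p : X} (hp : p ∈ P) {ε : ℝ} (hε : 0 < ε) :
    ∀ᶠ q in 𝓝[P] p, ∀ s ∈ Icc (0 : ℝ) 1, ‖Z s q - Z s p‖ ≤ ε := by
  obtain ⟨K, hK⟩ := hL p hp
  have hc := isCompact_graph_solution (hZ p hp)
  have hKD : ((fun s : ℝ => (s, p, Z s p)) '' Icc 0 1) ⊆ Icc 0 1 ×ˢ P ×ˢ univ := by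
    rintro _ ⟨s, hs, rfl⟩
    exact ⟨hs, hp, mem_univ _⟩
  -- The forcing is made so small that Grönwall's factor brings it back to ε; K + 1 replaces K
  -- because the Grönwall bound used here wants a constant at least 1.
  obtain ⟨δ, hδ, hd⟩ := exists_pos_forall_dist_lt_of_isCompact hg hc hKD
    (ε := ε / Real.exp (K + 1)) (by positivity)
  filter_upwards [hK, self_mem_nhdsWithin, mem_nhdsWithin_of_mem_nhds (Metric.ball_mem_nhds p hδ)]
    with q hqK hqP hq
  have hε' : ε / Real.exp (K + 1) * Real.exp (K + 1) = ε :=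
    div_mul_cancel₀ _ (Real.exp_pos _).ne'
  rw [← hε']
  refine norm_le_mul_exp_of_norm_deriv_le (y := fun s => Z s q - Z s p)
    (y' := fun s => g s q (Z s q) - g s p (Z s p)) (by simp) (by positivity)
    (fun s hs => (hZ q hqP s hs).sub (hZ p hp s hs)) (by simp [h0 p hp, h0 q hqP])
    fun s hs => ?_
  have h1 := (hqK s hs).dist_le_mul (Z s q) (Z s p)
  have h2 := hd _ ⟨s, hs, rfl⟩ (s, q, Z s p) ⟨hs, hqP, mem_univ _⟩ (by
    simpa [Prod.dist_eq, hδ] using hq)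
  rw [dist_eq_norm, dist_eq_norm] at h1
  rw [dist_eq_norm] at h2
  have h3 := norm_add_le (g s q (Z s q) - g s q (Z s p)) (g s q (Z s p) - g s p (Z s p))
  rw [sub_add_sub_cancel] at h3
  have h4 := norm_nonneg (Z s q - Z s p)
  nlinarith

/-- Solutions of a parametric equation are jointly continuous in time and parameter. -/
theorem continuousOn_solution {z₀ : E}
    (hg : ContinuousOn (fun q : ℝ × X × E => g q.1 q.2.1 q.2.2) (Icc 0 1 ×ˢ P ×ˢ univ))
    (hL : ∀ p ∈ P, ∃ K : ℝ≥0, ∀ᶠ q in 𝓝[P] p, ∀ s ∈ Icc (0 : ℝ) 1, LipschitzWith K (g s q))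
    (h0 : ∀ p ∈ P, Z 0 p = z₀)
    (hZ : ∀ p ∈ P, ∀ s ∈ Icc (0 : ℝ) 1,
      HasDerivWithinAt (Z · p) (g s p (Z s p)) (Icc 0 1) s) :
    ContinuousOn (fun q : ℝ × X => Z q.1 q.2) (Icc 0 1 ×ˢ P) := by
  rintro ⟨s, p⟩ ⟨hs, hp⟩
  refine Metric.tendsto_nhds.2 fun ε hε => ?_
  have h1 := eventually_forall_norm_solution_sub_le hg hL h0 hZ hp (half_pos hε)
  have h2 : ∀ᶠ r in 𝓝[Icc 0 1] s, dist (Z r p) (Z s p) < ε / 2 :=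
    (hZ p hp s hs).continuousWithinAt.tendsto.eventually (Metric.ball_mem_nhds _ (half_pos hε))
  rw [nhdsWithin_prod_eq]
  filter_upwards [(h2.and self_mem_nhdsWithin).prod_mk h1] with q hq
  obtain ⟨⟨ha, hb⟩, hc⟩ := hq
  have := dist_triangle (Z q.1 q.2) (Z q.1 p) (Z s p)
  have hc' := hc q.1 hb
  rw [← dist_eq_norm] at hc'
  linarith

/-- Differentiability of the solution with respect to the parameter; the derivative solves the
linearized equation. -/
theorem hasFDerivWithinAt_solution {z₀ : E} {M : ℝ → X →L[ℝ] E}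
    {g' : ℝ × X × E → (ℝ × X × E →L[ℝ] E)} (hP : Convex ℝ P)
    (hg : ∀ q ∈ Icc (0 : ℝ) 1 ×ˢ P ×ˢ univ, HasFDerivWithinAt
      (fun q : ℝ × X × E => g q.1 q.2.1 q.2.2) (g' q) (Icc 0 1 ×ˢ P ×ˢ univ) q)
    (hg' : ContinuousOn g' (Icc 0 1 ×ˢ P ×ˢ univ))
    (hcont : ContinuousOn (fun q : ℝ × X => Z q.1 q.2) (Icc 0 1 ×ˢ P))
    (h0 : ∀ p ∈ P, Z 0 p = z₀)
    (hZ : ∀ p ∈ P, ∀ s ∈ Icc (0 : ℝ) 1,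
      HasDerivWithinAt (Z · p) (g s p (Z s p)) (Icc 0 1) s)
    {p : X} (hp : p ∈ P) (hM0 : M 0 = 0)
    (hM : ∀ s ∈ Icc (0 : ℝ) 1, HasDerivWithinAt M
      ((g' (s, p, Z s p)).comp ((0 : X →L[ℝ] ℝ).prod ((ContinuousLinearMap.id ℝ X).prod (M s))))
      (Icc 0 1) s) :
    ∀ s ∈ Icc (0 : ℝ) 1, HasFDerivWithinAt (Z s) (M s) P p := by
  have hc := isCompact_graph_solution (hZ p hp)
  have hKD : ((fun s : ℝ => (s, p, Z s p)) '' Icc 0 1) ⊆ Icc 0 1 ×ˢ P ×ˢ univ := by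
    rintro _ ⟨s, hs, rfl⟩
    exact ⟨hs, hp, mem_univ _⟩
  have hMc : ContinuousOn M (Icc 0 1) := fun s hs => (hM s hs).continuousWithinAt
  obtain ⟨CM, hCM⟩ := isCompact_Icc.exists_bound_of_continuousOn hMc
  obtain ⟨Cg, hCg⟩ := hc.exists_bound_of_continuousOn (hg'.mono hKD)
  have hCM0 : 0 ≤ CM := (norm_nonneg _).trans (hCM 0 (by simp))
  have hCg0 : 0 ≤ Cg := (norm_nonneg _).trans (hCg _ ⟨0, by simp, rfl⟩)
  -- The estimate is proved for all times at once, as Grönwall's inequality needs the whole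
  -- trajectory.
  suffices h : ∀ c > 0, ∀ᶠ q in 𝓝[P] p, ∀ s ∈ Icc (0 : ℝ) 1,
      ‖Z s q - Z s p - M s (q - p)‖ ≤ c * ‖q - p‖ by
    intro s hs
    rw [hasFDerivWithinAt_iff_isLittleO, Asymptotics.isLittleO_iff]
    intro c hc
    filter_upwards [h c hc] with q hq using hq s hs
  intro c hcpos
  -- η is the allowed oscillation of g' near the trajectory. The remainder obeys Grönwall with
  -- constant Cg + 1 (Cg from the linear part, 1 from η ≤ 1) and forcing η (1 + CM) ‖q - p‖.
  let η : ℝ := min 1 (c / ((1 + CM) * Real.exp (Cg + 1)))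
  have hη : 0 < η := lt_min one_pos (by positivity)
  have hη1 : η ≤ 1 := min_le_left _ _
  have hηc : η * (1 + CM) * Real.exp (Cg + 1) ≤ c := by
    have := min_le_right 1 (c / ((1 + CM) * Real.exp (Cg + 1)))
    rw [le_div_iff₀ (by positivity)] at this
    linarith
  obtain ⟨δ, hδ, hd⟩ := exists_pos_forall_dist_lt_of_isCompact hg' hc hKD hη
  have hnear : ∀ᶠ q in 𝓝[P] p, ∀ s ∈ Icc (0 : ℝ) 1, dist (Z s q) (Z s p) < δ := by
    obtain ⟨δ', hδ', hd'⟩ := exists_pos_forall_dist_lt_of_isCompact hcont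
      (K := Icc 0 1 ×ˢ {p}) (isCompact_Icc.prod isCompact_singleton)
      (prod_mono le_rfl (singleton_subset_iff.2 hp)) hδ
    filter_upwards [self_mem_nhdsWithin, mem_nhdsWithin_of_mem_nhds (Metric.ball_mem_nhds p hδ')]
      with q hqP hq s hs
    exact hd' (s, p) ⟨hs, rfl⟩ (s, q) ⟨hs, hqP⟩ (by simpa [Prod.dist_eq, hδ'] using hq)
  filter_upwards [hnear, self_mem_nhdsWithin,
    mem_nhdsWithin_of_mem_nhds (Metric.ball_mem_nhds p hδ)] with q hZq hqP hq
  have hfin : ∀ s ∈ Icc (0 : ℝ) 1,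
      ‖Z s q - Z s p - M s (q - p)‖ ≤ η * (1 + CM) * ‖q - p‖ * Real.exp (Cg + 1) := by
    refine norm_le_mul_exp_of_norm_deriv_le (y := fun s => Z s q - Z s p - M s (q - p))
      (y' := fun s => g s q (Z s q) - g s p (Z s p) -
        g' (s, p, Z s p) (0, q - p, M s (q - p))) (by linarith) (by positivity)
      (fun s hs => ?_) (by simp [h0 p hp, h0 q hqP, hM0]) fun s hs => ?_
    · have h1 := (hM s hs).clm_apply (hasDerivWithinAt_const s (Icc (0 : ℝ) 1) (q - p))
      refine ((hZ q hqP s hs).sub (hZ p hp s hs)).sub (h1.congr_deriv ?_)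
      simp
    -- On this convex piece of the domain g' stays within η of its value on the trajectory, so the
    -- mean value inequality bounds the linearization error.
    · let D : Set (ℝ × X × E) := (Icc 0 1 ×ˢ P ×ˢ univ) ∩ Metric.ball (s, p, Z s p) δ
      have hD : Convex ℝ D :=
        ((convex_Icc 0 1).prod (hP.prod convex_univ)).inter (convex_ball _ _)
      have hk : (s, p, Z s p) ∈ D := ⟨hKD ⟨s, hs, rfl⟩, Metric.mem_ball_self hδ⟩
      have hk' : (s, q, Z s q) ∈ D := by
        refine ⟨⟨hs, hqP, mem_univ _⟩, ?_⟩
        have := hZq s hs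
        simp only [Metric.mem_ball, Prod.dist_eq, dist_self]
        exact max_lt hδ (max_lt hq this)
      have h1 := hD.norm_image_sub_le_of_norm_hasFDerivWithin_le'
        (φ := g' (s, p, Z s p)) (C := η)
        (fun x hx => (hg x hx.1).mono inter_subset_left) (fun x hx => by
          have := hd _ ⟨s, hs, rfl⟩ x hx.1 hx.2
          rw [dist_eq_norm] at this
          exact this.le) hk hk'
      simp only [Prod.mk_sub_mk, sub_self] at h1
      have h2 : ‖((0 : ℝ), q - p, Z s q - Z s p)‖ ≤ ‖q - p‖ + ‖Z s q - Z s p‖ := by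
        simp only [Prod.norm_mk, norm_zero]
        refine max_le (by positivity) (max_le ?_ ?_) <;> linarith [norm_nonneg (q - p),
          norm_nonneg (Z s q - Z s p)]
      have h3 : g s q (Z s q) - g s p (Z s p) - g' (s, p, Z s p) (0, q - p, M s (q - p))
          = (g s q (Z s q) - g s p (Z s p) - g' (s, p, Z s p) (0, q - p, Z s q - Z s p))
            + g' (s, p, Z s p) (0, 0, Z s q - Z s p - M s (q - p)) := by
        rw [sub_add, ← map_sub]
        simp
      have h4 : ‖g' (s, p, Z s p) (0, 0, Z s q - Z s p - M s (q - p))‖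
          ≤ Cg * ‖Z s q - Z s p - M s (q - p)‖ := by
        refine ((g' (s, p, Z s p)).le_of_opNorm_le (hCg _ ⟨s, hs, rfl⟩) _).trans_eq ?_
        simp [Prod.norm_mk]
      have h5 : ‖Z s q - Z s p‖ ≤ ‖Z s q - Z s p - M s (q - p)‖ + CM * ‖q - p‖ := by
        have := norm_add_le (Z s q - Z s p - M s (q - p)) (M s (q - p))
        rw [sub_add_cancel] at this
        exact this.trans (by gcongr; exact (M s).le_of_opNorm_le (hCM s hs) _)
      rw [h3]
      refine (norm_add_le _ _).trans ?_
      have h6 := norm_nonneg (Z s q - Z s p - M s (q - p))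
      have h7 := mul_le_mul_of_nonneg_left (h2.trans (add_le_add_right h5 _)) hη.le
      have h8 := mul_le_mul_of_nonneg_right hη1 h6
      nlinarith
  intro s hs
  refine (hfin s hs).trans ?_
  calc _ = η * (1 + CM) * Real.exp (Cg + 1) * ‖q - p‖ := by ring
    _ ≤ c * ‖q - p‖ := by gcongr

/-- A function of two variables with a partial derivative in the first variable and a continuous
partial derivative in the second one is differentiable. -/
theorem hasFDerivWithinAt_of_partial {Y F : Type*} [NormedAddCommGroup Y] [NormedSpace ℝ Y]
    [NormedAddCommGroup F] [NormedSpace ℝ F] {S : Set Y} (hP : Convex ℝ P) {h : Y → X → F}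
    {h₁ : Y →L[ℝ] F} {h₂ : Y → X → X →L[ℝ] F} {s : Y} {p : X} (hs : s ∈ S) (hp : p ∈ P)
    (hh₁ : HasFDerivWithinAt (h · p) h₁ S s)
    (hh₂ : ∀ r ∈ S, ∀ q ∈ P, HasFDerivWithinAt (h r) (h₂ r q) P q)
    (hc : ContinuousOn (fun q : Y × X => h₂ q.1 q.2) (S ×ˢ P)) :
    HasFDerivWithinAt (fun q : Y × X => h q.1 q.2) (h₁.coprod (h₂ s p)) (S ×ˢ P) (s, p) := by
  rw [hasFDerivWithinAt_iff_isLittleO, Asymptotics.isLittleO_iff] at hh₁ ⊢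
  intro c hcpos
  have h1 := hh₁ (half_pos hcpos)
  obtain ⟨δ, hδ, hd⟩ := Metric.continuousWithinAt_iff.1 (hc (s, p) ⟨hs, hp⟩) (c / 2)
    (half_pos hcpos)
  have hPev : ∀ᶠ q in 𝓝[P] p, q ∈ P := self_mem_nhdsWithin
  have hSb : ∀ᶠ r in 𝓝[S] s, r ∈ Metric.ball s δ :=
    mem_nhdsWithin_of_mem_nhds (Metric.ball_mem_nhds s hδ)
  have hPb : ∀ᶠ q in 𝓝[P] p, q ∈ Metric.ball p δ :=
    mem_nhdsWithin_of_mem_nhds (Metric.ball_mem_nhds p hδ)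
  rw [nhdsWithin_prod_eq]
  filter_upwards [((h1.and self_mem_nhdsWithin).and hSb).prod_mk (hPev.and hPb)] with q hq
  obtain ⟨⟨⟨ha, hb⟩, hb'⟩, hPq, hbq⟩ := hq
  have h2 := (hP.inter (convex_ball p δ)).norm_image_sub_le_of_norm_hasFDerivWithin_le'
    (f := h q.1) (f' := h₂ q.1) (φ := h₂ s p) (C := c / 2)
    (fun x hx => (hh₂ q.1 hb x hx.1).mono inter_subset_left) (fun x hx => by
      have := hd (x := (q.1, x)) ⟨hb, hx.1⟩ (max_lt hb' hx.2)
      rw [dist_eq_norm] at this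
      exact this.le) ⟨hp, Metric.mem_ball_self hδ⟩ ⟨hPq, hbq⟩
  -- The increment passes through (q.1, p): the mean value inequality handles the second variable,
  -- differentiability at s the first.
  have h3 : h q.1 q.2 - h s p - (h₁.coprod (h₂ s p)) (q - (s, p))
      = (h q.1 q.2 - h q.1 p - h₂ s p (q.2 - p)) + (h q.1 p - h s p - h₁ (q.1 - s)) := by
    simp only [ContinuousLinearMap.coprod_apply, Prod.fst_sub, Prod.snd_sub]
    abel
  rw [h3]
  refine (norm_add_le _ _).trans ?_
  have h4 : ‖q.1 - s‖ ≤ ‖q - (s, p)‖ := norm_fst_le (q - (s, p))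
  have h5 : ‖q.2 - p‖ ≤ ‖q - (s, p)‖ := norm_snd_le (q - (s, p))
  nlinarith

/-- Affine in m: a constant plus a fixed composition. It supplies the smoothness of the linearized
vector field in its unknown. -/
theorem contDiff_zero_prod_id_prod : ContDiff ℝ ∞ (fun m : X →L[ℝ] E =>
    (0 : X →L[ℝ] ℝ).prod ((ContinuousLinearMap.id ℝ X).prod m)) := by
  have h : (fun m : X →L[ℝ] E => (0 : X →L[ℝ] ℝ).prod ((ContinuousLinearMap.id ℝ X).prod m))
      = fun m => (ContinuousLinearMap.inr ℝ ℝ (X × E)).comp (ContinuousLinearMap.inl ℝ X E)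
        + ((ContinuousLinearMap.inr ℝ ℝ (X × E)).comp (ContinuousLinearMap.inr ℝ X E)).comp m := by
    ext m x <;> simp
  rw [h]
  exact contDiff_const.add (contDiff_const.clm_comp contDiff_id)

/-- The linearized equation has, for every parameter, a solution vanishing at time `0`. -/
theorem exists_solution_linearized [CompleteSpace E]
    {g' : ℝ × X × E → (ℝ × X × E →L[ℝ] E)}
    (hg' : ContinuousOn g' (Icc 0 1 ×ˢ P ×ˢ univ))
    (hcont : ContinuousOn (fun q : ℝ × X => Z q.1 q.2) (Icc 0 1 ×ˢ P)) :
    ∃ M : ℝ → X → X →L[ℝ] E, ContinuousOn (fun q : ℝ × X => M q.1 q.2) (Icc 0 1 ×ˢ P) ∧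
      ∀ p ∈ P, M 0 p = 0 ∧ ∀ s ∈ Icc (0 : ℝ) 1, HasDerivWithinAt (M · p)
        ((g' (s, p, Z s p)).comp
          ((0 : X →L[ℝ] ℝ).prod ((ContinuousLinearMap.id ℝ X).prod (M s p)))) (Icc 0 1) s := by
  let G : ℝ → X → (X →L[ℝ] E) → (X →L[ℝ] E) := fun s p m =>
    (g' (s, p, Z s p)).comp ((0 : X →L[ℝ] ℝ).prod ((ContinuousLinearMap.id ℝ X).prod m))
  have hA : ContinuousOn (fun q : ℝ × X => g' (q.1, q.2, Z q.1 q.2)) (Icc 0 1 ×ˢ P) :=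
    hg'.comp (by fun_prop) fun q hq => ⟨hq.1, hq.2, mem_univ _⟩
  -- The equation is affine in m: in a difference the time and identity entries cancel, leaving the
  -- operator norm of g' as Lipschitz constant.
  have hlip : ∀ s p (K : ℝ≥0), ‖g' (s, p, Z s p)‖ ≤ K → LipschitzWith K (G s p) := by
    intro s p K hK
    refine LipschitzWith.of_dist_le_mul fun m m' => ?_
    rw [dist_eq_norm, dist_eq_norm]
    have h1 : G s p m - G s p m' = (g' (s, p, Z s p)).comp
        ((0 : X →L[ℝ] ℝ).prod ((0 : X →L[ℝ] X).prod (m - m'))) := by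
      ext x
      simp only [G, sub_apply, ContinuousLinearMap.comp_apply, ← map_sub]
      simp
    rw [h1]
    refine (ContinuousLinearMap.opNorm_comp_le _ _).trans ?_
    gcongr
    refine ContinuousLinearMap.opNorm_le_bound _ (norm_nonneg _) fun x => ?_
    simpa [Prod.norm_mk] using (m - m').le_opNorm x
  have hGc : ContinuousOn (fun q : ℝ × X × (X →L[ℝ] E) => G q.1 q.2.1 q.2.2)
      (Icc 0 1 ×ˢ P ×ˢ univ) := by
    have h1 : ContinuousOn (fun q : ℝ × X × (X →L[ℝ] E) => g' (q.1, q.2.1, Z q.1 q.2.1))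
        (Icc 0 1 ×ˢ P ×ˢ univ) :=
      hA.comp (f := fun q : ℝ × X × (X →L[ℝ] E) => (q.1, q.2.1)) (by fun_prop)
        fun q hq => ⟨hq.1, hq.2.1⟩
    have h2 : Continuous (fun q : ℝ × X × (X →L[ℝ] E) =>
        (0 : X →L[ℝ] ℝ).prod ((ContinuousLinearMap.id ℝ X).prod q.2.2)) :=
      (contDiff_zero_prod_id_prod (X := X) (E := E)).continuous.comp (by fun_prop)
    exact h1.clm_comp h2.continuousOn
  have hex : ∀ p ∈ P, ∃ u : ℝ → X →L[ℝ] E, u 0 = 0 ∧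
      ∀ s ∈ Icc (0 : ℝ) 1, HasDerivWithinAt u (G s p (u s)) (Icc 0 1) s := by
    intro p hp
    obtain ⟨C, hC⟩ := isCompact_Icc.exists_bound_of_continuousOn
      (hA.comp (f := fun s : ℝ => (s, p)) (s := Icc 0 1) (by fun_prop) fun s hs => ⟨hs, hp⟩)
    refine exists_solution_of_lipschitzWith (g := fun s => G s p) (L := C.toNNReal)
      (hGc.comp (f := fun q : ℝ × (X →L[ℝ] E) => (q.1, p, q.2)) (by fun_prop)
        fun q hq => ⟨hq.1, hp, mem_univ _⟩) (fun s hs => hlip s p _ ?_) 0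
    exact (hC s hs).trans (Real.le_coe_toNNReal C)
  choose! u hu0 hu using hex
  refine ⟨fun s p => u p s, ?_, fun p hp => ⟨hu0 p hp, hu p hp⟩⟩
  refine continuousOn_solution (g := G) (Z := fun s p => u p s) (z₀ := 0) hGc (fun p hp => ?_)
    hu0 hu
  obtain ⟨C, hC⟩ := isCompact_Icc.exists_bound_of_continuousOn
    (hA.comp (f := fun s : ℝ => (s, p)) (s := Icc 0 1) (by fun_prop) fun s hs => ⟨hs, hp⟩)
  obtain ⟨δ, hδ, hd⟩ := exists_pos_forall_dist_lt_of_isCompact hA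
    (K := Icc 0 1 ×ˢ {p}) (isCompact_Icc.prod isCompact_singleton)
    (prod_mono le_rfl (singleton_subset_iff.2 hp)) one_pos
  -- C bounds g' along the trajectory of p, and 1 is its permitted variation for parameters within
  -- δ.
  refine ⟨(C + 1).toNNReal, ?_⟩
  filter_upwards [self_mem_nhdsWithin, mem_nhdsWithin_of_mem_nhds (Metric.ball_mem_nhds p hδ)]
    with q hqP hq s hs
  refine hlip s q _ (le_trans ?_ (Real.le_coe_toNNReal _))
  have h1 := hd (s, p) ⟨hs, rfl⟩ (s, q) ⟨hs, hqP⟩ (by simpa [Prod.dist_eq, hδ] using hq)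
  rw [dist_eq_norm] at h1
  have h2 := hC s hs
  simp only [Function.comp_apply] at h2
  have h3 := norm_add_le (g' (s, q, Z s q) - g' (s, p, Z s p)) (g' (s, p, Z s p))
  rw [sub_add_cancel] at h3
  linarith

/-- Smooth dependence on parameters: a jointly continuous solution of a smooth parametric
differential equation, with fixed initial value, is jointly smooth in time and parameter. -/
theorem contDiffOn_nat_solution (hP : Convex ℝ P) (hPu : UniqueDiffOn ℝ P) (n : ℕ) :
    ∀ {E : Type u} [NormedAddCommGroup E] [NormedSpace ℝ E] [CompleteSpace E] {z₀ : E}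
      {g : ℝ → X → E → E} {Z : ℝ → X → E},
      ContDiffOn ℝ ∞ (fun q : ℝ × X × E => g q.1 q.2.1 q.2.2) (Icc 0 1 ×ˢ P ×ˢ univ) →
      ContinuousOn (fun q : ℝ × X => Z q.1 q.2) (Icc 0 1 ×ˢ P) →
      (∀ p ∈ P, Z 0 p = z₀) →
      (∀ p ∈ P, ∀ s ∈ Icc (0 : ℝ) 1,
        HasDerivWithinAt (Z · p) (g s p (Z s p)) (Icc 0 1) s) →
      ContDiffOn ℝ n (fun q : ℝ × X => Z q.1 q.2) (Icc 0 1 ×ˢ P) := by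
  -- The induction replaces the state space E by E × (X →L[ℝ] E), so E is quantified inside.
  -- Continuity of Z is assumed in place of a Lipschitz condition because the augmented field need
  -- not be globally Lipschitz.
  induction n with
  | zero =>
    intro E _ _ _ z₀ g Z _ hZc _ _
    exact contDiffOn_zero.2 hZc
  | succ n ih =>
    intro E _ _ _ z₀ g Z hg hZc h0 hZ
    have hD : UniqueDiffOn ℝ (Icc (0 : ℝ) 1 ×ˢ P ×ˢ (univ : Set E)) :=
      (uniqueDiffOn_Icc zero_lt_one).prod (hPu.prod uniqueDiffOn_univ)
    let g' := fderivWithin ℝ (fun q : ℝ × X × E => g q.1 q.2.1 q.2.2) (Icc 0 1 ×ˢ P ×ˢ univ)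
    have hg'd : ContDiffOn ℝ ∞ g' (Icc 0 1 ×ˢ P ×ˢ univ) := hg.fderivWithin hD (by simp)
    have hgg' : ∀ q ∈ Icc (0 : ℝ) 1 ×ˢ P ×ˢ univ, HasFDerivWithinAt
        (fun q : ℝ × X × E => g q.1 q.2.1 q.2.2) (g' q) (Icc 0 1 ×ˢ P ×ˢ univ) q :=
      fun q hq => (hg.differentiableOn (by simp) q hq).hasFDerivWithinAt
    obtain ⟨M, hMc, hM⟩ := exists_solution_linearized (Z := Z) hg'd.continuousOn hZc
    have hZd : ∀ s ∈ Icc (0 : ℝ) 1, ∀ p ∈ P, HasFDerivWithinAt (Z s) (M s p) P p :=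
      fun s hs p hp => hasFDerivWithinAt_solution (M := fun s => M s p) hP hgg'
        hg'd.continuousOn hZc h0 hZ hp (hM p hp).1 (hM p hp).2 s hs
    -- The solution together with its parameter derivative solves a system of the same type, so the
    -- pair is of class C^n by induction; then Z has a C^n total derivative.
    let G : ℝ → X → E × (X →L[ℝ] E) → E × (X →L[ℝ] E) := fun s p y =>
      (g s p y.1, (g' (s, p, y.1)).comp
        ((0 : X →L[ℝ] ℝ).prod ((ContinuousLinearMap.id ℝ X).prod y.2)))
    have hpr : ContDiff ℝ ∞ (fun q : ℝ × X × E × (X →L[ℝ] E) =>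
        (0 : X →L[ℝ] ℝ).prod ((ContinuousLinearMap.id ℝ X).prod q.2.2.2)) :=
      contDiff_zero_prod_id_prod.comp (by fun_prop)
    have hproj : ContDiffOn ℝ ∞ (fun q : ℝ × X × E × (X →L[ℝ] E) => (q.1, q.2.1, q.2.2.1))
        (Icc 0 1 ×ˢ P ×ˢ univ) := by fun_prop
    have hmaps : MapsTo (fun q : ℝ × X × E × (X →L[ℝ] E) => (q.1, q.2.1, q.2.2.1))
        (Icc 0 1 ×ˢ P ×ˢ univ) (Icc 0 1 ×ˢ P ×ˢ univ) :=
      fun q hq => ⟨hq.1, hq.2.1, mem_univ _⟩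
    have hG : ContDiffOn ℝ ∞ (fun q : ℝ × X × E × (X →L[ℝ] E) => G q.1 q.2.1 q.2.2)
        (Icc 0 1 ×ˢ P ×ˢ univ) :=
      (hg.comp hproj hmaps).prodMk ((hg'd.comp hproj hmaps).clm_comp hpr.contDiffOn)
    have hZM := ih (g := G) (Z := fun s p => (Z s p, M s p)) (z₀ := (z₀, 0)) hG
      (hZc.prodMk hMc) (fun p hp => by simp [h0 p hp, (hM p hp).1])
      (fun p hp s hs => (hZ p hp s hs).prodMk ((hM p hp).2 s hs))
    have hZn : ContDiffOn ℝ n (fun q : ℝ × X => Z q.1 q.2) (Icc 0 1 ×ˢ P) := hZM.fst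
    have hMn : ContDiffOn ℝ n (fun q : ℝ × X => M q.1 q.2) (Icc 0 1 ×ˢ P) := hZM.snd
    have hgn : ContDiffOn ℝ n (fun q : ℝ × X => g q.1 q.2 (Z q.1 q.2)) (Icc 0 1 ×ˢ P) :=
      (hg.of_le (mod_cast le_top)).comp
        (contDiffOn_fst.prodMk (contDiffOn_snd.prodMk hZn))
        fun q hq => ⟨hq.1, hq.2, mem_univ _⟩
    push_cast
    refine (contDiffOn_succ_iff_hasFDerivWithinAt_of_uniqueDiffOn
      ((uniqueDiffOn_Icc zero_lt_one).prod hPu)).2 ⟨by simp, fun q =>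
        (ContinuousLinearMap.toSpanSingleton ℝ (g q.1 q.2 (Z q.1 q.2))).coprod (M q.1 q.2), ?_, ?_⟩
    · have h1 : ContDiffOn ℝ n (fun q : ℝ × X =>
          ContinuousLinearMap.toSpanSingleton ℝ (g q.1 q.2 (Z q.1 q.2))) (Icc 0 1 ×ˢ P) :=
        (ContinuousLinearMap.toSpanSingletonCLE (𝕜 := ℝ) (E := E)).contDiff.comp_contDiffOn hgn
      have h2 : (fun q : ℝ × X => (ContinuousLinearMap.toSpanSingleton ℝ
          (g q.1 q.2 (Z q.1 q.2))).coprod (M q.1 q.2)) = fun q : ℝ × X =>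
          (ContinuousLinearMap.toSpanSingleton ℝ (g q.1 q.2 (Z q.1 q.2))).comp
            (ContinuousLinearMap.fst ℝ ℝ X) + (M q.1 q.2).comp
            (ContinuousLinearMap.snd ℝ ℝ X) := by
        ext q <;> simp
      rw [h2]
      exact (h1.clm_comp contDiffOn_const).add (hMn.clm_comp contDiffOn_const)
    · rintro ⟨s, p⟩ ⟨hs, hp⟩
      exact hasFDerivWithinAt_of_partial hP hs hp (hZ p hp s hs).hasFDerivWithinAt hZd hMc

/-- The Lipschitz hypothesis serves only to make Z jointly continuous; the finite-order result then
applies at every order. -/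
theorem contDiffOn_solution [CompleteSpace E] (hP : Convex ℝ P) (hPu : UniqueDiffOn ℝ P) {z₀ : E}
    (hg : ContDiffOn ℝ ∞ (fun q : ℝ × X × E => g q.1 q.2.1 q.2.2) (Icc 0 1 ×ˢ P ×ˢ univ))
    (hL : ∀ p ∈ P, ∃ K : ℝ≥0, ∀ᶠ q in 𝓝[P] p, ∀ s ∈ Icc (0 : ℝ) 1, LipschitzWith K (g s q))
    (h0 : ∀ p ∈ P, Z 0 p = z₀)
    (hZ : ∀ p ∈ P, ∀ s ∈ Icc (0 : ℝ) 1,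
      HasDerivWithinAt (Z · p) (g s p (Z s p)) (Icc 0 1) s) :
    ContDiffOn ℝ ∞ (fun q : ℝ × X => Z q.1 q.2) (Icc 0 1 ×ˢ P) :=
  contDiffOn_infty.2 fun n => contDiffOn_nat_solution hP hPu n hg
    (continuousOn_solution hg.continuousOn hL h0 hZ) h0 hZ

end ParametricODE

/-! ### The time interval [0, τ) -/

section Lifespan

variable {τ : ℝ≥0∞}

theorem zero_mem_lifespan (hτ : 0 < τ) : (0 : ℝ) ∈ lifespan τ := ⟨le_rfl, by simpa using hτ⟩

theorem mem_lifespan_of_le {s t : ℝ} (ht : t ∈ lifespan τ) (hs : 0 ≤ s) (hst : s ≤ t) :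
    s ∈ lifespan τ :=
  ⟨hs, (ENNReal.ofReal_le_ofReal hst).trans_lt ht.2⟩

theorem exists_gt_mem_lifespan {t : ℝ} (ht : t ∈ lifespan τ) : ∃ t₁ ∈ lifespan τ, t < t₁ := by
  obtain ⟨r, hr, hr'⟩ := ENNReal.lt_iff_exists_nnreal_btwn.1 ht.2
  have h : t < r := by
    rw [← ENNReal.ofReal_coe_nnreal] at hr
    exact (ENNReal.ofReal_lt_ofReal_iff_of_nonneg ht.1).1 hr
  exact ⟨r, ⟨r.2, by rwa [ENNReal.ofReal_coe_nnreal]⟩, h⟩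

theorem lifespan_mem_nhds {t : ℝ} (ht : t ∈ lifespan τ) (h0 : 0 < t) : lifespan τ ∈ 𝓝 t := by
  obtain ⟨t₁, ht₁, h⟩ := exists_gt_mem_lifespan ht
  filter_upwards [Ioo_mem_nhds h0 h] with s hs
  exact mem_lifespan_of_le ht₁ hs.1.le hs.2.le

theorem convex_lifespan : Convex ℝ (lifespan τ) :=
  (ordConnected_iff.2 fun _ hx _ hy _ _ hz =>
    mem_lifespan_of_le hy (hx.1.trans hz.1) hz.2).convex

theorem uniqueDiffOn_lifespan (hτ : 0 < τ) : UniqueDiffOn ℝ (lifespan τ) := by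
  obtain ⟨t₁, ht₁, h⟩ := exists_gt_mem_lifespan (zero_mem_lifespan hτ)
  refine uniqueDiffOn_convex convex_lifespan ⟨t₁, ?_⟩
  exact mem_interior_iff_mem_nhds.2 (lifespan_mem_nhds ht₁ h)

theorem uniqueDiffOn_lifespan_prod_univ (hτ : 0 < τ) (E : Type*) [NormedAddCommGroup E]
    [NormedSpace ℝ E] : UniqueDiffOn ℝ (lifespan τ ×ˢ (univ : Set E)) :=
  (uniqueDiffOn_lifespan hτ).prod uniqueDiffOn_univ

theorem convex_lifespan_prod_univ {E : Type*} [NormedAddCommGroup E] [NormedSpace ℝ E] :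
    Convex ℝ (lifespan τ ×ˢ (univ : Set E)) :=
  convex_lifespan.prod convex_univ

end Lifespan

/-! ### Characteristic curves, the backward flow, and primitives in time -/

/-- `c` solves the differential equation `c' = W(r, c)` on `[0, t]`. -/
def IsCurve {E : Type*} [NormedAddCommGroup E] [NormedSpace ℝ E] (W : ℝ → E → E) (t : ℝ)
    (c : ℝ → E) : Prop :=
  ∀ r ∈ Icc 0 t, HasDerivWithinAt c (W r (c r)) (Icc 0 t) r

theorem IsCurve.mono {E : Type*} [NormedAddCommGroup E] [NormedSpace ℝ E] {W : ℝ → E → E}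
    {t t' : ℝ} {c : ℝ → E} (hc : IsCurve W t c) (h : t' ≤ t) : IsCurve W t' c :=
  fun r hr => (hc r ⟨hr.1, hr.2.trans h⟩).mono (Icc_subset_Icc_right h)

/-- Uniqueness on `[0, 1]` for a Lipschitz differential equation. -/
theorem IsCurve.eq_of_lipschitzWith {E : Type*} [NormedAddCommGroup E] [NormedSpace ℝ E]
    {W : ℝ → E → E} {K : ℝ≥0} (hL : ∀ s ∈ Icc (0 : ℝ) 1, LipschitzWith K (W s)) {y z : ℝ → E}
    (hy : IsCurve W 1 y) (hz : IsCurve W 1 z) (h0 : y 0 = z 0) : ∀ s ∈ Icc (0 : ℝ) 1, y s = z s := by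
  refine ODE_solution_unique_of_mem_Icc_right (v := W) (s := fun _ => univ) (K := K)
    (fun t ht => (hL t ⟨ht.1, ht.2.le⟩).lipschitzOnWith)
    (fun s hs => (hy s hs).continuousWithinAt)
    (fun s hs => (hy s ⟨hs.1, hs.2.le⟩).mono_of_mem_nhdsWithin (Icc_mem_nhdsGE_of_mem hs))
    (fun _ _ => mem_univ _) (fun s hs => (hz s hs).continuousWithinAt)
    (fun s hs => (hz s ⟨hs.1, hs.2.le⟩).mono_of_mem_nhdsWithin (Icc_mem_nhdsGE_of_mem hs))
    (fun _ _ => mem_univ _) h0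

/-- The map sending `(t, x)` to the value at time `0` of the solution through `x` at time `t` is
smooth, up to the boundary `t = 0`. -/
theorem exists_backward_flow {E : Type} [NormedAddCommGroup E] [NormedSpace ℝ E] [CompleteSpace E]
    {τ : ℝ≥0∞} (hτ : 0 < τ) {W : ℝ → E → E}
    (hW : ContDiffOn ℝ ∞ (fun q : ℝ × E => W q.1 q.2) (lifespan τ ×ˢ univ))
    (hL : ∀ t₁ ∈ lifespan τ, ∃ K : ℝ≥0, ∀ t ∈ Icc 0 t₁, LipschitzWith K (W t)) :
    ∃ B : ℝ × E → E, ContDiffOn ℝ ∞ B (lifespan τ ×ˢ univ) ∧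
      (∀ t ∈ lifespan τ, ∀ c, IsCurve W t c → B (t, c t) = c 0) ∧
      ∀ t ∈ lifespan τ, ∀ x, ∃ c, c t = x ∧ IsCurve W t c := by
  let P : Set (ℝ × E) := lifespan τ ×ˢ univ
  -- With r = t(1 - s) and z = c - x, the backward problem from (t, x) has the fixed time interval
  -- [0, 1] and the fixed initial value 0; (t, x) becomes a mere parameter, and t = 0 needs no
  -- special treatment for smoothness.
  let g : ℝ → ℝ × E → E → E := fun s p z => -p.1 • W (p.1 * (1 - s)) (p.2 + z)
  have hmem : ∀ t₁ : ℝ, ∀ t ∈ Icc 0 t₁, ∀ s ∈ Icc (0 : ℝ) 1, t * (1 - s) ∈ Icc 0 t₁ := by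
    intro t₁ t ht s hs
    exact ⟨mul_nonneg ht.1 (by linarith [hs.2]), by nlinarith [ht.1, ht.2, hs.1, hs.2]⟩
  have hg : ContDiffOn ℝ ∞ (fun q : ℝ × (ℝ × E) × E => g q.1 q.2.1 q.2.2)
      (Icc 0 1 ×ˢ P ×ˢ univ) := by
    have h1 : ContDiffOn ℝ ∞ (fun q : ℝ × (ℝ × E) × E =>
        W (q.2.1.1 * (1 - q.1)) (q.2.1.2 + q.2.2)) (Icc 0 1 ×ˢ P ×ˢ univ) :=
      hW.comp (f := fun q : ℝ × (ℝ × E) × E => (q.2.1.1 * (1 - q.1), q.2.1.2 + q.2.2))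
        (by fun_prop) fun q hq => by
          have := hmem q.2.1.1 q.2.1.1 ⟨hq.2.1.1.1, le_rfl⟩ q.1 hq.1
          exact ⟨mem_lifespan_of_le hq.2.1.1 this.1 this.2, mem_univ _⟩
    exact (by fun_prop : ContDiff ℝ ∞ fun q : ℝ × (ℝ × E) × E => -q.2.1.1).contDiffOn.smul h1
  have hgL : ∀ t₁ ∈ lifespan τ, ∃ K : ℝ≥0, ∀ p : ℝ × E, p.1 ∈ Icc 0 t₁ →
      ∀ s ∈ Icc (0 : ℝ) 1, LipschitzWith K (g s p) := by
    intro t₁ ht₁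
    obtain ⟨K, hK⟩ := hL t₁ ht₁
    refine ⟨t₁.toNNReal * K, fun p hp s hs => LipschitzWith.of_dist_le_mul fun z z' => ?_⟩
    have h1 := (hK _ (hmem t₁ p.1 hp s hs)).dist_le_mul (p.2 + z) (p.2 + z')
    rw [dist_add_left] at h1
    simp only [g]
    rw [dist_smul₀, norm_neg, Real.norm_of_nonneg hp.1, NNReal.coe_mul,
      Real.coe_toNNReal _ ht₁.1, mul_assoc]
    exact mul_le_mul hp.2 h1 dist_nonneg ht₁.1
  have hex : ∀ p ∈ P, ∃ u : ℝ → E, u 0 = 0 ∧ IsCurve (fun s => g s p) 1 u := by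
    intro p hp
    obtain ⟨K, hK⟩ := hgL p.1 hp.1
    exact exists_solution_of_lipschitzWith (g := fun s => g s p)
      (hg.continuousOn.comp (f := fun q : ℝ × E => (q.1, p, q.2)) (by fun_prop)
        fun q hq => ⟨hq.1, hp, mem_univ _⟩) (hK p ⟨hp.1.1, le_rfl⟩) 0
  choose! Z hZ0 hZ using hex
  have hZs : ContDiffOn ℝ ∞ (fun q : ℝ × ℝ × E => Z q.2 q.1) (Icc 0 1 ×ˢ P) := by
    refine contDiffOn_solution (g := g) (Z := fun s p => Z p s) (z₀ := 0)
      convex_lifespan_prod_univ (uniqueDiffOn_lifespan_prod_univ hτ E) hg (fun p hp => ?_) hZ0 hZ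
    obtain ⟨t₁, ht₁, hlt⟩ := exists_gt_mem_lifespan hp.1
    obtain ⟨K, hK⟩ := hgL t₁ ht₁
    refine ⟨K, ?_⟩
    have h1 : ∀ᶠ q : ℝ × E in 𝓝[P] p, q.1 < t₁ :=
      mem_nhdsWithin_of_mem_nhds (continuous_fst.continuousAt.eventually (gt_mem_nhds hlt))
    filter_upwards [self_mem_nhdsWithin, h1] with q hq hq1
    exact hK q ⟨hq.1.1, hq1.le⟩
  refine ⟨fun p => p.2 + Z p 1, ?_, fun t ht c hc => ?_, fun t ht x => ?_⟩
  · exact contDiffOn_snd.add (hZs.comp (f := fun p : ℝ × E => ((1 : ℝ), p)) (by fun_prop)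
      fun p hp => ⟨by simp, hp⟩)
  · obtain ⟨K, hK⟩ := hgL t ht
    have hy : IsCurve (fun s => g s (t, c t)) 1 (fun s => c (t * (1 - s)) - c t) := by
      intro s hs
      have h1 : HasDerivWithinAt (fun s => t * (1 - s)) (-t) (Icc 0 1) s := by
        simpa using ((hasDerivAt_id s).const_sub 1).const_mul t |>.hasDerivWithinAt
      have h2 := (hc (t * (1 - s)) (hmem t t ⟨ht.1, le_rfl⟩ s hs)).scomp s h1
        (fun r hr => hmem t t ⟨ht.1, le_rfl⟩ r hr)
      simpa [g] using h2.sub_const (c t)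
    have h1 := IsCurve.eq_of_lipschitzWith (hK (t, c t) ⟨ht.1, le_rfl⟩)
      (hZ (t, c t) ⟨ht, mem_univ _⟩) hy (by simp [hZ0 (t, c t) ⟨ht, mem_univ _⟩]) 1 (by simp)
    simp [h1]
  · rcases ht.1.eq_or_lt with rfl | h0
    -- The rescaling below divides by t; for t = 0 the interval is a point and every derivative
    -- within it is admissible.
    · refine ⟨fun _ => x, rfl, fun r _ => ?_⟩
      rw [Icc_self]
      exact HasFDerivWithinAt.of_subsingleton subsingleton_singleton
    · have hp : (t, x) ∈ P := ⟨ht, mem_univ _⟩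
      refine ⟨fun r => x + Z (t, x) (1 - t⁻¹ * r), by simp [h0.ne', hZ0 _ hp], fun r hr => ?_⟩
      have hmaps : ∀ r ∈ Icc 0 t, 1 - t⁻¹ * r ∈ Icc (0 : ℝ) 1 := by
        intro r hr
        have h1 : 0 ≤ t⁻¹ * r := mul_nonneg (inv_nonneg.2 h0.le) hr.1
        have h2 : t⁻¹ * r ≤ 1 := by
          rw [inv_mul_le_iff₀ h0]; linarith [hr.2]
        exact ⟨by linarith, by linarith⟩
      have h1 : HasDerivWithinAt (fun r => 1 - t⁻¹ * r) (-t⁻¹) (Icc 0 t) r := by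
        simpa using ((hasDerivAt_id r).const_mul t⁻¹).const_sub 1 |>.hasDerivWithinAt
      have h2 := (hZ (t, x) hp _ (hmaps r hr)).scomp r h1 hmaps
      refine (h2.const_add x).congr_deriv ?_
      simp [g, smul_smul, h0.ne']

/-- Existence of smooth primitives in time. -/
theorem exists_primitive_in_time {E F : Type} [NormedAddCommGroup E] [NormedSpace ℝ E]
    [NormedAddCommGroup F] [NormedSpace ℝ F] [CompleteSpace F]
    {τ : ℝ≥0∞} (hτ : 0 < τ) {H : ℝ → E → F}
    (hH : ContDiffOn ℝ ∞ (fun q : ℝ × E => H q.1 q.2) (lifespan τ ×ˢ univ)) :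
    ∃ Φ : ℝ → E → F, ContDiffOn ℝ ∞ (fun q : ℝ × E => Φ q.1 q.2) (lifespan τ ×ˢ univ) ∧
      (∀ x, Φ 0 x = 0) ∧
      ∀ t ∈ lifespan τ, 0 < t → ∀ x, HasDerivAt (fun s => Φ s x) (H t x) t := by
  let P : Set (ℝ × E) := lifespan τ ×ˢ univ
  -- This encodes t ∫₀¹ H(ts, x) ds as a differential equation whose field ignores the unknown, so
  -- that smoothness up to t = 0 follows from parameter dependence.
  let g : ℝ → ℝ × E → F → F := fun s p _ => p.1 • H (p.1 * s) p.2
  have hmem : ∀ t ∈ lifespan τ, ∀ s ∈ Icc (0 : ℝ) 1, t * s ∈ lifespan τ := fun t ht s hs =>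
    mem_lifespan_of_le ht (mul_nonneg ht.1 hs.1) (mul_le_of_le_one_right ht.1 hs.2)
  have hg : ContDiffOn ℝ ∞ (fun q : ℝ × (ℝ × E) × F => g q.1 q.2.1 q.2.2)
      (Icc 0 1 ×ˢ P ×ˢ univ) := by
    have h1 : ContDiffOn ℝ ∞ (fun q : ℝ × (ℝ × E) × F => H (q.2.1.1 * q.1) q.2.1.2)
        (Icc 0 1 ×ˢ P ×ˢ univ) :=
      hH.comp (f := fun q : ℝ × (ℝ × E) × F => (q.2.1.1 * q.1, q.2.1.2))
        (by fun_prop) fun q hq => ⟨hmem _ hq.2.1.1 _ hq.1, mem_univ _⟩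
    exact (by fun_prop : ContDiff ℝ ∞ fun q : ℝ × (ℝ × E) × F => q.2.1.1).contDiffOn.smul h1
  have hgL : ∀ p : ℝ × E, ∀ s ∈ Icc (0 : ℝ) 1, LipschitzWith 0 (g s p) :=
    fun p s _ => LipschitzWith.const _
  have hex : ∀ p ∈ P, ∃ u : ℝ → F, u 0 = 0 ∧ IsCurve (fun s => g s p) 1 u := fun p hp =>
    exists_solution_of_lipschitzWith (g := fun s => g s p)
      (hg.continuousOn.comp (f := fun q : ℝ × F => (q.1, p, q.2)) (by fun_prop)
        fun q hq => ⟨hq.1, hp, mem_univ _⟩) (hgL p) 0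
  choose! Z hZ0 hZ using hex
  have hZs : ContDiffOn ℝ ∞ (fun q : ℝ × ℝ × E => Z q.2 q.1) (Icc 0 1 ×ˢ P) :=
    contDiffOn_solution (g := g) (Z := fun s p => Z p s) (z₀ := 0)
      convex_lifespan_prod_univ (uniqueDiffOn_lifespan_prod_univ hτ E) hg
      (fun p _ => ⟨0, Eventually.of_forall fun q => hgL q⟩) hZ0 hZ
  -- By uniqueness, the values at all times up to a later t₁ lie on the single trajectory with
  -- parameter (t₁, x). Differentiating that trajectory gives the time derivative of the primitive.
  have hscale : ∀ t ∈ lifespan τ, ∀ x, ∀ r ∈ Icc (0 : ℝ) 1, Z (t * r, x) 1 = Z (t, x) r := by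
    intro t ht x r hr
    have hp : (t, x) ∈ P := ⟨ht, mem_univ _⟩
    have hp' : (t * r, x) ∈ P := ⟨hmem t ht r hr, mem_univ _⟩
    have hmaps : ∀ s ∈ Icc (0 : ℝ) 1, r * s ∈ Icc (0 : ℝ) 1 := fun s hs =>
      ⟨mul_nonneg hr.1 hs.1, mul_le_one₀ hr.2 hs.1 hs.2⟩
    have hy : IsCurve (fun s => g s (t * r, x)) 1 (fun s => Z (t, x) (r * s)) := by
      intro s hs
      have h1 : HasDerivWithinAt (fun s => r * s) r (Icc 0 1) s := by
        simpa using (hasDerivAt_id s).const_mul r |>.hasDerivWithinAt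
      refine ((hZ (t, x) hp _ (hmaps s hs)).scomp s h1 hmaps).congr_deriv ?_
      simp [g, smul_smul, mul_comm r t, mul_assoc]
    have h1 := IsCurve.eq_of_lipschitzWith (hgL (t * r, x)) (hZ _ hp') hy
      (by simp [hZ0 _ hp, hZ0 _ hp']) 1 (by simp)
    simpa using h1
  refine ⟨fun t x => Z (t, x) 1, ?_, fun x => ?_, fun t ht h0 x => ?_⟩
  · exact hZs.comp (f := fun p : ℝ × E => ((1 : ℝ), p)) (by fun_prop) fun p hp => ⟨by simp, hp⟩
  · have h1 := hscale 0 (zero_mem_lifespan hτ) x 0 (by simp)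
    rw [zero_mul] at h1
    exact h1.trans (hZ0 _ ⟨zero_mem_lifespan hτ, mem_univ _⟩)
  · obtain ⟨t₁, ht₁, hlt⟩ := exists_gt_mem_lifespan ht
    have h1pos : 0 < t₁ := h0.trans hlt
    have hp : (t₁, x) ∈ P := ⟨ht₁, mem_univ _⟩
    have hmaps : ∀ s ∈ Ioo 0 t₁, t₁⁻¹ * s ∈ Ioo (0 : ℝ) 1 := by
      intro s hs
      refine ⟨mul_pos (inv_pos.2 h1pos) hs.1, ?_⟩
      rw [inv_mul_lt_iff₀ h1pos]
      linarith [hs.2]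
    have hm := hmaps t ⟨h0, hlt⟩
    have h1 : HasDerivAt (fun s => t₁⁻¹ * s) t₁⁻¹ t := by
      simpa using (hasDerivAt_id t).const_mul t₁⁻¹
    have h2 := ((hZ (t₁, x) hp _ ⟨hm.1.le, hm.2.le⟩).hasDerivAt
      (Icc_mem_nhds hm.1 hm.2)).scomp t h1
    have h3 : t₁⁻¹ • g (t₁⁻¹ * t) (t₁, x) (Z (t₁, x) (t₁⁻¹ * t)) = H t x := by
      simp [g, smul_smul, h1pos.ne']
    rw [h3] at h2
    refine h2.congr_of_eventuallyEq ?_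
    filter_upwards [Ioo_mem_nhds h0 hlt] with s hs
    have hs' := hmaps s hs
    have h4 := hscale t₁ ht₁ x _ ⟨hs'.1.le, hs'.2.le⟩
    rw [mul_inv_cancel_left₀ h1pos.ne'] at h4
    exact h4

/-! ### Calculus for functions smooth on [0, τ) × ℝ^d -/

section SmoothOnLifespan

variable {d : ℕ} {F G : Type*} [NormedAddCommGroup F] [NormedSpace ℝ F] [NormedAddCommGroup G]
  [NormedSpace ℝ G] {τ : ℝ≥0∞} {u : ℝ → Space d → F} {t : ℝ}

theorem SmoothOnLifespan.contDiff (hu : SmoothOnLifespan τ u) (ht : t ∈ lifespan τ) :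
    ContDiff ℝ ∞ (u t) := by
  rw [← contDiffOn_univ]
  exact hu.comp (f := fun x : Space d => (t, x)) (by fun_prop) fun x _ => ⟨ht, mem_univ _⟩

theorem SmoothOnLifespan.hasFDerivAt (hu : SmoothOnLifespan τ u) (ht : t ∈ lifespan τ)
    (x : Space d) : HasFDerivAt (u t) (fderiv ℝ (u t) x) x :=
  ((hu.contDiff ht).differentiable (by simp) x).hasFDerivAt

/-- The spatial derivative is the joint derivative within the slab restricted to spatial directions.
This remains valid at t = 0, since each time slice is the whole space. -/
theorem SmoothOnLifespan.fderiv (hτ : 0 < τ) (hu : SmoothOnLifespan τ u) :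
    SmoothOnLifespan τ (fun t x => fderiv ℝ (u t) x) := by
  have h1 := hu.fderivWithin (m := ∞) (uniqueDiffOn_lifespan_prod_univ hτ (Space d)) (by simp)
  refine ContDiffOn.congr (f := fun p => (fderivWithin ℝ (fun p : ℝ × Space d => u p.1 p.2)
    (lifespan τ ×ˢ univ) p).comp (ContinuousLinearMap.inr ℝ ℝ (Space d)))
    (h1.clm_comp contDiffOn_const) fun p hp => ?_
  have h2 := (hu.differentiableOn (by simp) p hp).hasFDerivWithinAt
  have h3 : HasFDerivWithinAt (fun y : Space d => (p.1, y)) (ContinuousLinearMap.inr ℝ ℝ (Space d))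
      univ p.2 := (hasFDerivAt_prodMk_right p.1 p.2).hasFDerivWithinAt
  have h4 := HasFDerivWithinAt.comp (t := lifespan τ ×ˢ univ) p.2 h2 h3
    (fun y _ => ⟨hp.1, mem_univ _⟩)
  exact (h4.hasFDerivAt univ_mem).fderiv

theorem SmoothOnLifespan.continuousOn_curve (hu : SmoothOnLifespan τ u) (ht : t ∈ lifespan τ)
    {c : ℝ → Space d} (hc : ContinuousOn c (Icc 0 t)) :
    ContinuousOn (fun r => u r (c r)) (Icc 0 t) :=
  ContinuousOn.comp (g := fun p : ℝ × Space d => u p.1 p.2) (f := fun r => (r, c r))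
    (ContDiffOn.continuousOn hu) (by fun_prop)
    fun _ hr => ⟨mem_lifespan_of_le ht hr.1 hr.2, mem_univ _⟩

theorem SmoothOnLifespan.contDiffAt (hu : SmoothOnLifespan τ u) (ht : t ∈ lifespan τ)
    (h0 : 0 < t) (x : Space d) : ContDiffAt ℝ ∞ (fun p : ℝ × Space d => u p.1 p.2) (t, x) :=
  ContDiffOn.contDiffAt hu (prod_mem_nhds (lifespan_mem_nhds ht h0) univ_mem)

/-- At positive times the slab is a neighbourhood of the point, so an unrestricted derivative exists
and its two components are the partial derivatives. -/
theorem SmoothOnLifespan.hasFDerivAt_uncurry (hu : SmoothOnLifespan τ u) (ht : t ∈ lifespan τ)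
    (h0 : 0 < t) (x : Space d) :
    HasFDerivAt (fun p : ℝ × Space d => u p.1 p.2)
      ((ContinuousLinearMap.toSpanSingleton ℝ (deriv (fun s => u s x) t)).coprod
        (_root_.fderiv ℝ (u t) x)) (t, x) := by
  have h1 := ((hu.contDiffAt ht h0 x).differentiableAt (by simp)).hasFDerivAt
  have h2 := HasFDerivAt.comp (f := fun s => (s, x)) t h1 (hasFDerivAt_prodMk_left t x)
  have h3 := HasFDerivAt.comp (f := fun y => (t, y)) x h1 (hasFDerivAt_prodMk_right t x)
  have e2 : deriv (fun s => u s x) t = _ := h2.hasDerivAt.deriv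
  have e3 : _root_.fderiv ℝ (u t) x = _ := h3.fderiv
  refine h1.congr_fderiv ?_
  ext
  · simp [e2]
  · simp [e3]

theorem SmoothOnLifespan.hasDerivAt (hu : SmoothOnLifespan τ u) (ht : t ∈ lifespan τ)
    (h0 : 0 < t) (x : Space d) : HasDerivAt (fun s => u s x) (deriv (fun s => u s x) t) t := by
  have h2 : DifferentiableAt ℝ (fun s => u s x) t :=
    (HasFDerivAt.comp (f := fun s => (s, x)) t (hu.hasFDerivAt_uncurry ht h0 x)
      (hasFDerivAt_prodMk_left t x)).differentiableAt
  exact h2.hasDerivAt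

/-- The derivative of a smooth function along a curve. -/
theorem SmoothOnLifespan.hasDerivWithinAt_curve (hu : SmoothOnLifespan τ u)
    (ht : t ∈ lifespan τ) (h0 : 0 < t) {c : ℝ → Space d} {c' : Space d} {S : Set ℝ}
    (hc : HasDerivWithinAt c c' S t) :
    HasDerivWithinAt (fun r => u r (c r))
      (deriv (fun s => u s (c t)) t + _root_.fderiv ℝ (u t) (c t) c') S t := by
  have h1 := (hu.hasFDerivAt_uncurry ht h0 (c t)).comp_hasDerivWithinAt_of_eq t
    ((hasDerivWithinAt_id t S).prodMk hc) rfl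
  refine h1.congr_deriv ?_
  simp

/-- Time and space derivatives commute. -/
theorem SmoothOnLifespan.hasDerivAt_fderiv (hu : SmoothOnLifespan τ u) (ht : t ∈ lifespan τ)
    (h0 : 0 < t) (x : Space d) :
    HasDerivAt (fun s => _root_.fderiv ℝ (u s) x)
      (_root_.fderiv ℝ (fun y => deriv (fun s => u s y) t) x) t := by
  let U := fun p : ℝ × Space d => u p.1 p.2
  have hU := hu.contDiffAt ht h0 x
  have hsymm : IsSymmSndFDerivAt ℝ U (t, x) := hU.isSymmSndFDerivAt (by
    rw [minSmoothness_of_isRCLikeNormedField]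
    exact WithTop.coe_le_coe.2 le_top)
  have hD : HasFDerivAt (_root_.fderiv ℝ U) (_root_.fderiv ℝ (_root_.fderiv ℝ U) (t, x)) (t, x) :=
    ((hU.fderiv_right (m := ∞) (by simp)).differentiableAt (by simp)).hasFDerivAt
  have hDt := (hD.comp t (hasFDerivAt_prodMk_left t x)).hasDerivAt
  have hDx := hD.comp x (hasFDerivAt_prodMk_right t x)
  have e1 : ∀ᶠ s in 𝓝 t, _root_.fderiv ℝ (u s) x
      = (_root_.fderiv ℝ U (s, x)).comp (ContinuousLinearMap.inr ℝ ℝ (Space d)) := by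
    filter_upwards [lifespan_mem_nhds ht h0, lt_mem_nhds h0] with s hs hs0
    rw [(hu.hasFDerivAt_uncurry hs hs0 x).fderiv, ContinuousLinearMap.coprod_comp_inr]
  have e2 : (fun y => deriv (fun s => u s y) t) = fun y => _root_.fderiv ℝ U (t, y) (1, 0) := by
    ext y
    rw [(hu.hasFDerivAt_uncurry ht h0 y).fderiv]
    simp
  have h1 := hDt.clm_comp (hasDerivAt_const t (ContinuousLinearMap.inr ℝ ℝ (Space d)))
  have h2 := hDx.clm_apply (hasFDerivAt_const ((1 : ℝ), (0 : Space d)) x)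
  refine (h1.congr_of_eventuallyEq e1).congr_deriv ?_
  rw [e2]
  refine Eq.trans ?_ h2.fderiv.symm
  ext h
  simpa using hsymm.eq (1, 0) (0, h)

end SmoothOnLifespan

/-- A function vanishing at `0` whose derivative is controlled by the function itself vanishes. -/
theorem eq_zero_of_norm_deriv_le {F : Type*} [NormedAddCommGroup F] [NormedSpace ℝ F]
    {y y' : ℝ → F} {t K : ℝ} (ht : 0 ≤ t) (hc : ContinuousOn y (Icc 0 t))
    (hd : ∀ r ∈ Ioo 0 t, HasDerivAt y (y' r) r) (hb : ∀ r ∈ Ioo 0 t, ‖y' r‖ ≤ K * ‖y r‖)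
    (h0 : y 0 = 0) : y t = 0 := by
  rcases ht.eq_or_lt with rfl | ht
  · exact h0
  -- The derivative is known only at positive times, so Grönwall starts at ε > 0, and ε → 0 uses
  -- continuity at 0.
  have h1 : ∀ᶠ ε in 𝓝[Ioo 0 t] 0, ‖y t‖ ≤ ‖y ε‖ * Real.exp (K * (t - ε)) := by
    filter_upwards [self_mem_nhdsWithin] with ε hε
    have h2 := norm_le_gronwallBound_of_norm_deriv_right_le (f := y) (f' := y') (δ := ‖y ε‖)
      (K := K) (ε := 0) (a := ε) (b := t) (hc.mono (Icc_subset_Icc_left hε.1.le))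
      (fun r hr => (hd r ⟨hε.1.trans_le hr.1, hr.2⟩).hasDerivWithinAt) le_rfl
      (fun r hr => by simpa using hb r ⟨hε.1.trans_le hr.1, hr.2⟩) t ⟨hε.2.le, le_rfl⟩
    rwa [gronwallBound_ε0] at h2
  have h3 : Tendsto (fun ε => ‖y ε‖ * Real.exp (K * (t - ε))) (𝓝[Ioo 0 t] 0) (𝓝 0) := by
    have h4 : Tendsto y (𝓝[Ioo 0 t] 0) (𝓝 0) := by
      have := (hc 0 ⟨le_rfl, ht.le⟩).tendsto
      rw [h0] at this
      exact this.mono_left (nhdsWithin_mono _ Ioo_subset_Icc_self)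
    have h5 : Tendsto (fun ε => Real.exp (K * (t - ε))) (𝓝[Ioo 0 t] 0)
        (𝓝 (Real.exp (K * (t - 0)))) :=
      ((by fun_prop : Continuous fun ε => Real.exp (K * (t - ε))).tendsto 0).mono_left
        nhdsWithin_le_nhds
    simpa using h4.norm.mul h5
  have : (𝓝[Ioo 0 t] (0 : ℝ)).NeBot := by
    rw [nhdsWithin_Ioo_eq_nhdsGT ht]
    infer_instance
  exact norm_le_zero_iff.1 (ge_of_tendsto h3 h1)

/-! ### Linear transport equations by characteristics -/

section Transport

variable {d : ℕ} {F : Type} [NormedAddCommGroup F] [NormedSpace ℝ F] {τ : ℝ≥0∞}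
  {w : ℝ → Space d → Space d} {q : ℝ → Space d → ℝ}

/-- A smooth solution of a linear transport equation with zero initial value vanishes. -/
theorem transport_eq_zero {u : ℝ → Space d → F}
    (hcurve : ∀ t ∈ lifespan τ, ∀ x, ∃ c, c t = x ∧ IsCurve w t c)
    (hq : SmoothOnLifespan τ q) (hu : SmoothOnLifespan τ u)
    (heq : ∀ t ∈ lifespan τ, 0 < t → ∀ x,
      deriv (fun s => u s x) t + fderiv ℝ (u t) x (w t x) + q t x • u t x = 0)
    (h0 : ∀ x, u 0 x = 0) : ∀ t ∈ lifespan τ, ∀ x, u t x = 0 := by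
  intro t ht x
  -- Along the characteristic through (t, x) the equation becomes y' = -q y, with q bounded on the
  -- compact time interval.
  obtain ⟨c, rfl, hc⟩ := hcurve t ht x
  have hcc : ContinuousOn c (Icc 0 t) := fun r hr => (hc r hr).continuousWithinAt
  obtain ⟨K, hK⟩ := isCompact_Icc.exists_bound_of_continuousOn (hq.continuousOn_curve ht hcc)
  refine eq_zero_of_norm_deriv_le (y := fun r => u r (c r)) (y' := fun r => -(q r (c r) • u r (c r)))
    (K := K) ht.1 (hu.continuousOn_curve ht hcc) (fun r hr => ?_) (fun r hr => ?_) (h0 _)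
  · have hr' := mem_lifespan_of_le ht hr.1.le hr.2.le
    have h1 := hu.hasDerivWithinAt_curve hr' hr.1 (hc r ⟨hr.1.le, hr.2.le⟩)
    refine (h1.hasDerivAt (Icc_mem_nhds hr.1 hr.2)).congr_deriv ?_
    exact eq_neg_of_add_eq_zero_left (heq r hr' hr.1 (c r))
  · rw [norm_neg, norm_smul]
    gcongr
    exact hK r ⟨hr.1.le, hr.2.le⟩

/-- Existence of smooth solutions of linear transport equations. -/
theorem exists_transport_solution (hτ : 0 < τ) (hw : SmoothOnLifespan τ w)
    (hq : SmoothOnLifespan τ q)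
    (hwL : ∀ t₁ ∈ lifespan τ, ∃ K : ℝ≥0, ∀ t ∈ Icc 0 t₁, LipschitzWith K (w t))
    (hqL : ∀ t₁ ∈ lifespan τ, ∃ K : ℝ≥0, ∀ t ∈ Icc 0 t₁, LipschitzWith K (q t))
    {a₀ : Space d → F} (ha₀ : ContDiff ℝ ∞ a₀) :
    ∃ a : ℝ → Space d → F, SmoothOnLifespan τ a ∧ a 0 = a₀ ∧
      (∀ t ∈ lifespan τ, 0 < t → ∀ x,
        deriv (fun s => a s x) t + fderiv ℝ (a t) x (w t x) + q t x • a t x = 0) := by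
  -- A scalar component is added to the characteristics to integrate q along them.
  let W : ℝ → Space d × ℝ → Space d × ℝ := fun t z => (w t z.1, q t z.1)
  have hW : ContDiffOn ℝ ∞ (fun p : ℝ × Space d × ℝ => W p.1 p.2) (lifespan τ ×ˢ univ) := by
    have h1 : ContDiffOn ℝ ∞ (fun p : ℝ × Space d × ℝ => (p.1, p.2.1)) (lifespan τ ×ˢ univ) := by
      fun_prop
    have h2 : MapsTo (fun p : ℝ × Space d × ℝ => (p.1, p.2.1)) (lifespan τ ×ˢ univ)
        (lifespan τ ×ˢ univ) := fun p hp => ⟨hp.1, mem_univ _⟩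
    exact (ContDiffOn.comp hw h1 h2).prodMk (ContDiffOn.comp hq h1 h2)
  obtain ⟨B, hB, hBc, hex⟩ := exists_backward_flow hτ hW fun t₁ ht₁ => by
    obtain ⟨K₁, h₁⟩ := hwL t₁ ht₁
    obtain ⟨K₂, h₂⟩ := hqL t₁ ht₁
    exact ⟨_, fun t ht => ((h₁ t ht).comp LipschitzWith.prod_fst).prodMk
      ((h₂ t ht).comp LipschitzWith.prod_fst)⟩
  -- Started from 0 at time t, the extra component equals minus the integral of q over [0, t] when
  -- it reaches time 0: the exponent of the classical formula.
  let a : ℝ → Space d → F := fun t x => Real.exp (B (t, (x, 0))).2 • a₀ (B (t, (x, 0))).1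
  have ha : SmoothOnLifespan τ a := by
    have h1 : ContDiffOn ℝ ∞ (fun p : ℝ × Space d => B (p.1, (p.2, 0))) (lifespan τ ×ˢ univ) :=
      hB.comp (f := fun p : ℝ × Space d => (p.1, (p.2, (0 : ℝ)))) (by fun_prop)
        fun p hp => ⟨hp.1, mem_univ _⟩
    exact h1.snd.exp.smul (ha₀.comp_contDiffOn h1.fst)
  refine ⟨a, ha, ?_, fun t ht h0 x => ?_⟩
  · ext x
    obtain ⟨c, hcx, hc⟩ := hex 0 (zero_mem_lifespan hτ) (x, 0)
    have h1 := hBc 0 (zero_mem_lifespan hτ) c hc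
    rw [hcx] at h1
    simp [a, h1]
  · obtain ⟨c, hcx, hc⟩ := hex t ht (x, 0)
    -- W does not depend on the extra component, so translating a curve in that direction gives
    -- another curve. This makes a explicit along the whole characteristic.
    have hshift : ∀ r ∈ Icc 0 t, B (r, ((c r).1, 0)) = ((c 0).1, (c 0).2 - (c r).2) := by
      intro r hr
      have h1 : IsCurve W r (fun s => c s - (0, (c r).2)) := by
        intro s hs
        simpa [W] using (hc.mono hr.2 s hs).sub_const (0, (c r).2)
      have h2 := hBc r (mem_lifespan_of_le ht hr.1 hr.2) _ h1
      have h3 : c r - (0, (c r).2) = ((c r).1, 0) := by ext <;> simp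
      have h4 : c 0 - (0, (c r).2) = ((c 0).1, (c 0).2 - (c r).2) := by ext <;> simp
      rw [← h3, ← h4]
      exact h2
    have ht' : t ∈ Icc 0 t := ⟨ht.1, le_rfl⟩
    have hc1 : HasDerivWithinAt (fun r => (c r).1) (w t x) (Icc 0 t) t := by
      have := (ContinuousLinearMap.fst ℝ (Space d) ℝ).hasFDerivAt.comp_hasDerivWithinAt t (hc t ht')
      simpa [W, hcx, Function.comp_def] using this
    have hc2 : HasDerivWithinAt (fun r => (c r).2) (q t x) (Icc 0 t) t := by
      have := (ContinuousLinearMap.snd ℝ (Space d) ℝ).hasFDerivAt.comp_hasDerivWithinAt t (hc t ht')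
      simpa [W, hcx, Function.comp_def] using this
    have h1 := ha.hasDerivWithinAt_curve ht h0 hc1
    have h2 : HasDerivWithinAt (fun r => Real.exp ((c 0).2 - (c r).2) • a₀ (c 0).1)
        (-(q t x • a t x)) (Icc 0 t) t := by
      refine ((hc2.const_sub (c 0).2).exp.smul_const (a₀ (c 0).1)).congr_deriv ?_
      have h3 := hshift t ht'
      rw [hcx] at h3
      simp [a, h3, hcx, smul_smul, mul_comm]
    have h3 : ∀ r ∈ Icc 0 t, a r (c r).1 = Real.exp ((c 0).2 - (c r).2) • a₀ (c 0).1 := by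
      intro r hr
      simp [a, hshift r hr]
    -- The chain rule and the explicit formula give two derivatives of a along the characteristic at
    -- the right endpoint t; equating them is the transport equation.
    have h4 := (uniqueDiffOn_Icc h0 t ht').eq_deriv _ h1 (h2.congr h3 (h3 t ht'))
    simp only [hcx] at h4
    rw [h4]
    simp

end Transport

/-! ### Gradient, divergence, Laplacian and rotation -/

section VectorCalculus

variable {d : ℕ}

/-- The Riesz isomorphism as a real linear map. -/
def rieszCLM (d : ℕ) : StrongDual ℝ (Space d) →L[ℝ] Space d where
  toFun := (InnerProductSpace.toDual ℝ (Space d)).symm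
  map_add' := map_add _
  map_smul' c l := by simp
  cont := (InnerProductSpace.toDual ℝ (Space d)).symm.continuous

theorem gradient_eq_comp (g : Space d → ℝ) :
    ∇ g = fun x => (InnerProductSpace.toDual ℝ (Space d)).symm (fderiv ℝ g x) := rfl

theorem gradient_neg (g : Space d → ℝ) (x : Space d) : ∇ (fun y => -g y) x = -∇ g x := by
  simp only [gradient_eq_comp]
  rw [fderiv_fun_neg, map_neg]

/-- The Riesz map is an isometry. This exchanges bounds on v from order one with bounds on Φ from
order two. -/
theorem norm_iteratedFDeriv_gradient (g : Space d → ℝ) (n : ℕ) (x : Space d) :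
    ‖iteratedFDeriv ℝ n (∇ g) x‖ = ‖iteratedFDeriv ℝ (n + 1) g x‖ := by
  rw [← norm_iteratedFDeriv_fderiv]
  exact (InnerProductSpace.toDual ℝ (Space d)).symm.norm_iteratedFDeriv_comp_left _ _ _

/-- The divergence as a continuous linear function of the derivative. -/
def traceCLM (d : ℕ) : (Space d →L[ℝ] Space d) →L[ℝ] ℝ :=
  ∑ i, (EuclideanSpace.proj i).comp
    (ContinuousLinearMap.apply ℝ (Space d) (EuclideanSpace.single i (1 : ℝ)))

theorem divergence_eq_traceCLM (F : Space d → Space d) (x : Space d) :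
    divergence F x = traceCLM d (fderiv ℝ F x) := by
  simp [divergence, traceCLM]

/-- The map `x ↦ x^⊥` as a continuous linear map. -/
def perpCLM (d : ℕ) : Space d →L[ℝ] Space d :=
  LinearMap.toContinuousLinearMap (Matrix.toEuclideanLin (perpMatrix d))

theorem perp_eq_perpCLM : (perp : Space d → Space d) = perpCLM d := rfl

/-- The matrix J has zero diagonal, so the rotation field is divergence free. -/
theorem traceCLM_perpCLM : traceCLM d (perpCLM d) = 0 := by
  have h : ∀ i, (perpCLM d (EuclideanSpace.single i (1 : ℝ))) i = 0 := by
    intro i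
    change ((perpMatrix d).mulVec (Pi.single i (1 : ℝ))) i = 0
    rw [Matrix.mulVec_single_one]
    simp only [Matrix.col_apply, perpMatrix]
    split_ifs <;> first | omega | rfl
  simp [traceCLM, h]

/-- Product rule; the rotation survives only in the drift, not in the zero-order coefficient. -/
theorem divergence_smul_sub_perp {ρ : Space d → ℝ} {v : Space d → Space d} {x : Space d} (Ω : ℝ)
    (hρ : DifferentiableAt ℝ ρ x) (hv : DifferentiableAt ℝ v x) :
    divergence (fun y => ρ y • (v y - Ω • perp y)) x
      = fderiv ℝ ρ x (v x - Ω • perp x) + divergence v x * ρ x := by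
  have h1 : HasFDerivAt (fun y => v y - Ω • perp y) (fderiv ℝ v x - Ω • perpCLM d) x :=
    hv.hasFDerivAt.sub ((perpCLM d).hasFDerivAt.const_smul Ω)
  have h2 := hρ.hasFDerivAt.fun_smul h1
  rw [divergence_eq_traceCLM, divergence_eq_traceCLM, h2.fderiv, map_add, map_smul,
    map_sub, map_smul, traceCLM_perpCLM]
  have h3 : ∀ (l : Space d →L[ℝ] ℝ) (z : Space d), traceCLM d (l.smulRight z) = l z := by
    intro l z
    have hz : z = ∑ i, z i • EuclideanSpace.single i (1 : ℝ) := by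
      ext j
      simp [Pi.single_apply]
    conv_rhs => rw [hz, map_sum]
    simp [traceCLM, mul_comm]
  rw [h3]
  simp only [smul_eq_mul]
  ring

theorem laplacian_eq_divergence_gradient {g : Space d → ℝ} (hg : ContDiff ℝ ∞ g) (x : Space d) :
    Laplacian.laplacian g x = divergence (∇ g) x := by
  rw [InnerProductSpace.laplacian_eq_iteratedFDeriv_orthonormalBasis g
    (EuclideanSpace.basisFun (Fin d) ℝ), divergence]
  refine Finset.sum_congr rfl fun i _ => ?_
  have h1 : HasFDerivAt (fderiv ℝ g) (fderiv ℝ (fderiv ℝ g) x) x :=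
    ((hg.fderiv_right (m := ∞) (by simp)).differentiable (by simp) x).hasFDerivAt
  have h2 := (rieszCLM d).hasFDerivAt.comp x h1
  have h4 : fderiv ℝ (∇ g) x = _ := h2.fderiv
  rw [h4, iteratedFDeriv_two_apply]
  have h3 : ∀ z : Space d, z i = inner ℝ z (EuclideanSpace.single i (1 : ℝ)) := fun z => by
    simp [EuclideanSpace.inner_single_right]
  rw [h3]
  simp [rieszCLM]

end VectorCalculus

/-! ### The correspondence between the two systems -/

section Solutions

variable {d : ℕ} {τ : ℝ≥0∞}

theorem SmoothOnLifespan.gradient (hτ : 0 < τ) {Φ : ℝ → Space d → ℝ}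
    (hΦ : SmoothOnLifespan τ Φ) : SmoothOnLifespan τ (fun t => ∇ (Φ t)) :=
  (InnerProductSpace.toDual ℝ (Space d)).symm.contDiff.comp_contDiffOn (hΦ.fderiv hτ)

theorem SmoothOnLifespan.divergence (hτ : 0 < τ) {v : ℝ → Space d → Space d}
    (hv : SmoothOnLifespan τ v) : SmoothOnLifespan τ (fun t => Superfluid.divergence (v t)) := by
  have h : (fun t => Superfluid.divergence (v t))
      = fun t x => traceCLM d (_root_.fderiv ℝ (v t) x) := by
    ext t x
    exact divergence_eq_traceCLM _ _
  rw [h]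
  exact (traceCLM d).contDiff.comp_contDiffOn (hv.fderiv hτ)

/-- Time derivative and gradient commute. -/
theorem SmoothOnLifespan.hasDerivAt_gradient {Φ : ℝ → Space d → ℝ} (hΦ : SmoothOnLifespan τ Φ)
    {t : ℝ} (ht : t ∈ lifespan τ) (h0 : 0 < t) (x : Space d) :
    HasDerivAt (fun s => ∇ (Φ s) x) (∇ (fun y => deriv (fun s => Φ s y) t) x) t :=
  (rieszCLM d).hasFDerivAt.comp_hasDerivAt t (hΦ.hasDerivAt_fderiv ht h0 x)

/-- The Bernoulli function `|v|²/2 - Ω x^⊥ · v + V + f(ρ)`. -/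
def bernoulli (Ω : ℝ) (V : Space d → ℝ) (f : ℝ → ℝ) (ρ : ℝ → Space d → ℝ)
    (v : ℝ → Space d → Space d) (t : ℝ) (y : Space d) : ℝ :=
  ‖v t y‖ ^ 2 / 2 - Ω * inner ℝ (perp y) (v t y) + V y + f (ρ t y)

theorem SmoothOnLifespan.bernoulli {Ω : ℝ} {V : Space d → ℝ} {f : ℝ → ℝ} {ρ : ℝ → Space d → ℝ}
    {v : ℝ → Space d → Space d} (hV : ContDiff ℝ ∞ V) (hf : ContDiff ℝ ∞ f)
    (hρ : SmoothOnLifespan τ ρ) (hv : SmoothOnLifespan τ v) :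
    SmoothOnLifespan τ (bernoulli Ω V f ρ v) := by
  have h1 : ContDiffOn ℝ ∞ (fun p : ℝ × Space d => ‖v p.1 p.2‖ ^ 2 / 2) (lifespan τ ×ˢ univ) :=
    (ContDiffOn.norm_sq ℝ hv).div_const 2
  have h2 : ContDiffOn ℝ ∞ (fun p : ℝ × Space d => Ω * inner ℝ (perp p.2) (v p.1 p.2))
      (lifespan τ ×ˢ univ) := by
    rw [perp_eq_perpCLM]
    exact contDiffOn_const.mul (ContDiffOn.inner ℝ
      ((perpCLM d).contDiff.comp contDiff_snd).contDiffOn hv)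
  exact ((h1.sub h2).add (hV.comp contDiff_snd).contDiffOn).add (hf.comp_contDiffOn hρ)

/-- The squared modulus of a solution of a transport equation solves a transport equation. -/
theorem normSq_transport {a : ℝ → Space d → ℂ} (ha : SmoothOnLifespan τ a) {t : ℝ}
    (ht : t ∈ lifespan τ) (h0 : 0 < t) {x w : Space d} {q : ℝ}
    (h : deriv (fun s => a s x) t + fderiv ℝ (a t) x w + (q / 2) • a t x = 0) :
    deriv (fun s => ‖a s x‖ ^ 2) t + fderiv ℝ (fun y => ‖a t y‖ ^ 2) x w + q • ‖a t x‖ ^ 2 = 0 := by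
  have h1 := (ha.hasDerivAt ht h0 x).norm_sq.deriv
  have h2 := (ha.hasFDerivAt ht x).norm_sq.fderiv
  rw [h1, h2]
  -- Pairing with 2a in the real inner product of ℂ turns derivatives of a into derivatives of |a|²,
  -- and the coefficient q/2 into q.
  have h3 := congrArg (fun z => 2 * inner ℝ (a t x) z) h
  simp only [inner_add_right, inner_smul_right, inner_zero_right, real_inner_self_eq_norm_sq] at h3
  simp only [smul_apply, ContinuousLinearMap.comp_apply, innerSL_apply_apply,
    smul_eq_mul]
  simp only [two_smul]
  linarith

/-- The amplitude equation is a transport equation. -/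
theorem amplitude_iff {A B C a : ℂ} {Ω q : ℝ} :
    A + B + (1 / 2 : ℂ) * a * (q : ℂ) - (Ω : ℂ) * C = 0 ↔ A + (B - Ω • C) + (q / 2) • a = 0 := by
  rw [Complex.real_smul, Complex.real_smul]
  push_cast
  constructor <;> intro h <;> linear_combination h

theorem SmoothOnLifespan.normSq {a : ℝ → Space d → ℂ} (ha : SmoothOnLifespan τ a) :
    SmoothOnLifespan τ (fun t x => ‖a t x‖ ^ 2) :=
  ContDiffOn.norm_sq ℝ ha

variable {Ω : ℝ} {V : Space d → ℝ} {f : ℝ → ℝ} {a₀ : Space d → ℂ} {Φ₀ : Space d → ℝ}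

theorem IsWKBSolution.transport_eq {a : ℝ → Space d → ℂ} {Φ : ℝ → Space d → ℝ}
    (h : IsWKBSolution Ω V f a₀ Φ₀ τ a Φ) {t : ℝ} (ht : t ∈ lifespan τ) (h0 : 0 < t)
    (x : Space d) : deriv (fun s => a s x) t + fderiv ℝ (a t) x (∇ (Φ t) x - Ω • perp x)
      + (divergence (∇ (Φ t)) x / 2) • a t x = 0 := by
  have h1 := h.amplitude_eq t ht h0 x
  rw [laplacian_eq_divergence_gradient (h.smooth_phase.contDiff ht)] at h1
  rw [map_sub, map_smul]
  exact amplitude_iff.1 h1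

theorem IsWKBSolution.deriv_phase {a : ℝ → Space d → ℂ} {Φ : ℝ → Space d → ℝ}
    (h : IsWKBSolution Ω V f a₀ Φ₀ τ a Φ) {t : ℝ} (ht : t ∈ lifespan τ) (h0 : 0 < t)
    (x : Space d) : deriv (fun s => Φ s x) t
      = -bernoulli Ω V f (fun t x => ‖a t x‖ ^ 2) (fun t => ∇ (Φ t)) t x := by
  have h1 := h.phase_eq t ht h0 x
  rw [bernoulli]
  linarith

/-- A solution of the WKB system gives a solution of the hydrodynamical system. -/
theorem IsWKBSolution.isHydroSolution (hτ : 0 < τ) {a : ℝ → Space d → ℂ} {Φ : ℝ → Space d → ℝ}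
    (h : IsWKBSolution Ω V f a₀ Φ₀ τ a Φ) :
    IsHydroSolution Ω V f (fun x => ‖a₀ x‖ ^ 2) (∇ Φ₀) τ
      (fun t x => ‖a t x‖ ^ 2) (fun t => ∇ (Φ t)) where
  smooth_density := h.smooth_amplitude.normSq
  smooth_velocity := h.smooth_phase.gradient hτ
  bounded_derivs := fun t₁ ht₁ n hn => by
    obtain ⟨C, hC⟩ := h.bounded_derivs t₁ ht₁ (n + 1) (by omega)
    exact ⟨C, fun t ht x => (norm_iteratedFDeriv_gradient _ _ _).trans_le (hC t ht x)⟩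
  nonneg := fun _ _ _ => sq_nonneg _
  initial_density := by simp only [h.initial_amplitude]
  initial_velocity := by simp only [h.initial_phase]
  continuity_eq := fun t ht h0 x => by
    rw [divergence_smul_sub_perp Ω
      (h.smooth_amplitude.normSq.hasFDerivAt ht x).differentiableAt
      ((h.smooth_phase.gradient hτ).hasFDerivAt ht x).differentiableAt, ← add_assoc]
    exact normSq_transport h.smooth_amplitude ht h0 (h.transport_eq ht h0 x)
  momentum_eq := fun t ht h0 x => by
    rw [(h.smooth_phase.hasDerivAt_gradient ht h0 x).deriv]
    simp only [h.deriv_phase ht h0]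
    rw [gradient_neg]
    exact neg_add_cancel _

theorem lipschitzWith_of_norm_iteratedFDeriv_one_le {F : Type*} [NormedAddCommGroup F]
    [NormedSpace ℝ F] {u : Space d → F} (hu : Differentiable ℝ u) {C : ℝ}
    (hC : ∀ x, ‖iteratedFDeriv ℝ 1 u x‖ ≤ C) : LipschitzWith C.toNNReal u := by
  refine lipschitzWith_of_nnnorm_fderiv_le hu fun x => ?_
  rw [← NNReal.coe_le_coe, coe_nnnorm, ← norm_iteratedFDeriv_one]
  exact (hC x).trans (Real.le_coe_toNNReal C)

variable {ρ₀ : Space d → ℝ} {v₀ : Space d → Space d} {ρ : ℝ → Space d → ℝ}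
  {v : ℝ → Space d → Space d}

theorem IsHydroSolution.transport_eq (h : IsHydroSolution Ω V f ρ₀ v₀ τ ρ v) {t : ℝ}
    (ht : t ∈ lifespan τ) (h0 : 0 < t) (x : Space d) :
    deriv (fun s => ρ s x) t + fderiv ℝ (ρ t) x (v t x - Ω • perp x)
      + divergence (v t) x • ρ t x = 0 := by
  have h1 := h.continuity_eq t ht h0 x
  rwa [divergence_smul_sub_perp Ω (h.smooth_density.hasFDerivAt ht x).differentiableAt
    (h.smooth_velocity.hasFDerivAt ht x).differentiableAt, ← add_assoc] at h1

theorem IsHydroSolution.smooth_transport (h : IsHydroSolution Ω V f ρ₀ v₀ τ ρ v) :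
    SmoothOnLifespan τ (fun t x => v t x - Ω • perp x) := by
  rw [perp_eq_perpCLM]
  exact ContDiffOn.sub h.smooth_velocity
    (((perpCLM d).contDiff.comp contDiff_snd).const_smul Ω).contDiffOn

/-- Bounded first derivatives of v and linearity of the rotation suffice; v itself may grow at
infinity. This makes the characteristics global. -/
theorem IsHydroSolution.lipschitz_transport (h : IsHydroSolution Ω V f ρ₀ v₀ τ ρ v) :
    ∀ t₁ ∈ lifespan τ, ∃ K : ℝ≥0, ∀ t ∈ Icc 0 t₁,
      LipschitzWith K (fun x => v t x - Ω • perp x) := by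
  intro t₁ ht₁
  obtain ⟨C, hC⟩ := h.bounded_derivs t₁ ht₁ 1 le_rfl
  refine ⟨C.toNNReal + ‖Ω • perpCLM d‖₊, fun t ht => ?_⟩
  have hd := (h.smooth_velocity.contDiff (mem_lifespan_of_le ht₁ ht.1 ht.2)).differentiable
    (by simp)
  exact (lipschitzWith_of_norm_iteratedFDeriv_one_le hd (hC t ht)).sub
    (Ω • perpCLM d).lipschitz

/-- Follows from the bound on second derivatives of v. It is needed because this coefficient is a
component of the augmented characteristic field. -/
theorem IsHydroSolution.lipschitz_divergence (h : IsHydroSolution Ω V f ρ₀ v₀ τ ρ v) :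
    ∀ t₁ ∈ lifespan τ, ∃ K : ℝ≥0, ∀ t ∈ Icc 0 t₁,
      LipschitzWith K (fun x => divergence (v t) x / 2) := by
  intro t₁ ht₁
  obtain ⟨C, hC⟩ := h.bounded_derivs t₁ ht₁ 2 one_le_two
  refine ⟨‖(2 : ℝ)⁻¹ • traceCLM d‖₊ * C.toNNReal, fun t ht => ?_⟩
  have hd : Differentiable ℝ (fderiv ℝ (v t)) :=
    ((h.smooth_velocity.contDiff (mem_lifespan_of_le ht₁ ht.1 ht.2)).fderiv_right (m := ∞)
      (by simp)).differentiable (by simp)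
  have h1 := ((2 : ℝ)⁻¹ • traceCLM d).lipschitz.comp
    (lipschitzWith_of_norm_iteratedFDeriv_one_le hd fun x =>
      (norm_iteratedFDeriv_fderiv (n := 1)).trans_le (hC t ht x))
  have h2 : (fun x => divergence (v t) x / 2)
      = ((2 : ℝ)⁻¹ • traceCLM d) ∘ fderiv ℝ (v t) := by
    ext x
    simp [divergence_eq_traceCLM, div_eq_inv_mul]
  rw [h2]
  exact h1

theorem IsHydroSolution.exists_curve (hτ : 0 < τ) (h : IsHydroSolution Ω V f ρ₀ v₀ τ ρ v) :
    ∀ t ∈ lifespan τ, ∀ x, ∃ c, c t = x ∧ IsCurve (fun t x => v t x - Ω • perp x) t c := by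
  obtain ⟨_, _, _, hc⟩ := exists_backward_flow hτ (W := fun t x => v t x - Ω • perp x)
    h.smooth_transport h.lipschitz_transport
  exact hc

theorem IsHydroSolution.smooth_half_divergence (hτ : 0 < τ)
    (h : IsHydroSolution Ω V f ρ₀ v₀ τ ρ v) :
    SmoothOnLifespan τ (fun t x => divergence (v t) x / 2) :=
  ContDiffOn.div_const (h.smooth_velocity.divergence hτ) 2

/-- The phase of a solution of the hydrodynamical system. -/
theorem IsHydroSolution.exists_phase (hτ : 0 < τ) (hV : ContDiff ℝ ∞ V) (hf : ContDiff ℝ ∞ f)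
    (hΦ₀ : ContDiff ℝ ∞ Φ₀) (h : IsHydroSolution Ω V f ρ₀ (∇ Φ₀) τ ρ v) :
    ∃ Φ : ℝ → Space d → ℝ, SmoothOnLifespan τ Φ ∧ Φ 0 = Φ₀ ∧
      (∀ t ∈ lifespan τ, 0 < t → ∀ x,
        HasDerivAt (fun s => Φ s x) (-bernoulli Ω V f ρ v t x) t) ∧
      ∀ t ∈ lifespan τ, v t = ∇ (Φ t) := by
  have hB : SmoothOnLifespan τ (bernoulli Ω V f ρ v) :=
    SmoothOnLifespan.bernoulli hV hf h.smooth_density h.smooth_velocity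
  obtain ⟨Ψ, hΨ, hΨ0, hΨd⟩ := exists_primitive_in_time hτ
    (H := fun t x => -bernoulli Ω V f ρ v t x) (ContDiffOn.neg hB)
  have hΦ : SmoothOnLifespan τ (fun t x => Φ₀ x + Ψ t x) :=
    ContDiffOn.add (hΦ₀.comp contDiff_snd).contDiffOn hΨ
  have hΦd : ∀ t ∈ lifespan τ, 0 < t → ∀ x,
      HasDerivAt (fun s => Φ₀ x + Ψ s x) (-bernoulli Ω V f ρ v t x) t :=
    fun t ht h0 x => (hΨd t ht h0 x).const_add _
  have hinit : (fun x => Φ₀ x + Ψ 0 x) = Φ₀ := by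
    ext x
    simp [hΨ0]
  refine ⟨fun t x => Φ₀ x + Ψ t x, hΦ, hinit, hΦd, fun t ht => ?_⟩
  ext1 x
  have hconst : ContinuousOn (fun _ : ℝ => x) (Icc 0 t) := continuousOn_const
  -- By the momentum equation v - ∇Φ is constant in time at each point, hence K = 0, and it vanishes
  -- initially.
  refine sub_eq_zero.1 (eq_zero_of_norm_deriv_le (K := 0) (y' := fun _ => 0)
    (y := fun r => v r x - ∇ (fun x => Φ₀ x + Ψ r x) x) ht.1
    ((h.smooth_velocity.continuousOn_curve ht hconst).sub
      ((hΦ.gradient hτ).continuousOn_curve ht hconst)) (fun r hr => ?_) (by simp) ?_)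
  · have hr' := mem_lifespan_of_le ht hr.1.le hr.2.le
    have h1 := hΦ.hasDerivAt_gradient hr' hr.1 x
    have h2 : (fun y => deriv (fun s => Φ₀ y + Ψ s y) r)
        = fun y => -bernoulli Ω V f ρ v r y := by
      ext y
      exact (hΦd r hr' hr.1 y).deriv
    rw [h2, gradient_neg] at h1
    refine ((h.smooth_velocity.hasDerivAt hr' hr.1 x).sub h1).congr_deriv ?_
    rw [sub_neg_eq_add]
    exact h.momentum_eq r hr' hr.1 x
  · simp only [hinit, h.initial_velocity, sub_self]

/-- A solution of the hydrodynamical system comes from a solution of the WKB system. -/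
theorem IsHydroSolution.exists_isWKBSolution (hτ : 0 < τ) (hV : ContDiff ℝ ∞ V)
    (hf : ContDiff ℝ ∞ f) (ha₀ : ContDiff ℝ ∞ a₀) (hΦ₀ : ContDiff ℝ ∞ Φ₀)
    (h : IsHydroSolution Ω V f (fun x => ‖a₀ x‖ ^ 2) (∇ Φ₀) τ ρ v) :
    ∃ (a : ℝ → Space d → ℂ) (Φ : ℝ → Space d → ℝ), IsWKBSolution Ω V f a₀ Φ₀ τ a Φ ∧
      ∀ t ∈ lifespan τ, ∀ x, ρ t x = ‖a t x‖ ^ 2 ∧ v t x = ∇ (Φ t) x := by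
  obtain ⟨Φ, hΦ, hΦ0, hΦd, hvΦ⟩ := h.exists_phase hτ hV hf hΦ₀
  obtain ⟨a, ha, ha0, hat⟩ := exists_transport_solution hτ h.smooth_transport
    (h.smooth_half_divergence hτ) h.lipschitz_transport h.lipschitz_divergence ha₀
  -- Both densities solve the same linear transport equation with the same initial value.
  have hρ : ∀ t ∈ lifespan τ, ∀ x, ρ t x - ‖a t x‖ ^ 2 = 0 := by
    refine transport_eq_zero (u := fun t x => ρ t x - ‖a t x‖ ^ 2) (h.exists_curve hτ)
      (h.smooth_velocity.divergence hτ) (ContDiffOn.sub h.smooth_density ha.normSq)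
      (fun t ht h0 x => ?_) (fun x => by simp [h.initial_density, ha0])
    have h1 := normSq_transport ha ht h0 (hat t ht h0 x)
    have h2 := h.transport_eq ht h0 x
    rw [((h.smooth_density.hasDerivAt ht h0 x).fun_sub (ha.normSq.hasDerivAt ht h0 x)).deriv,
      ((h.smooth_density.hasFDerivAt ht x).fun_sub (ha.normSq.hasFDerivAt ht x)).fderiv]
    simp only [sub_apply, smul_eq_mul] at h1 h2 ⊢
    linarith
  have hρ' : ∀ t ∈ lifespan τ, ∀ x, ρ t x = ‖a t x‖ ^ 2 := fun t ht x => sub_eq_zero.1 (hρ t ht x)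
  refine ⟨a, Φ, ⟨ha, hΦ, fun t₁ ht₁ n hn => ?_, ha0, hΦ0, fun t ht h0 x => ?_,
    fun t ht h0 x => ?_⟩, fun t ht x => ⟨hρ' t ht x, congrFun (hvΦ t ht) x⟩⟩
  · obtain ⟨m, rfl⟩ : ∃ m, n = m + 1 := ⟨n - 1, by omega⟩
    obtain ⟨C, hC⟩ := h.bounded_derivs t₁ ht₁ m (by omega)
    refine ⟨C, fun t ht x => ?_⟩
    rw [← norm_iteratedFDeriv_gradient, ← hvΦ t (mem_lifespan_of_le ht₁ ht.1 ht.2)]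
    exact hC t ht x
  · rw [(hΦd t ht h0 x).deriv, ← hvΦ t ht, ← hρ' t ht x, bernoulli]
    ring
  · have h1 := hat t ht h0 x
    rw [map_sub, map_smul] at h1
    rw [laplacian_eq_divergence_gradient (hΦ.contDiff ht), ← hvΦ t ht]
    exact amplitude_iff.2 h1

/-- The WKB solution corresponding to a solution of the hydrodynamical system is unique. -/
theorem IsHydroSolution.isWKBSolution_unique (hτ : 0 < τ)
    (h : IsHydroSolution Ω V f ρ₀ v₀ τ ρ v) {a b : ℝ → Space d → ℂ} {Φ Ψ : ℝ → Space d → ℝ}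
    (ha : IsWKBSolution Ω V f a₀ Φ₀ τ a Φ)
    (hρa : ∀ t ∈ lifespan τ, ∀ x, ρ t x = ‖a t x‖ ^ 2 ∧ v t x = ∇ (Φ t) x)
    (hb : IsWKBSolution Ω V f a₀ Φ₀ τ b Ψ)
    (hρb : ∀ t ∈ lifespan τ, ∀ x, ρ t x = ‖b t x‖ ^ 2 ∧ v t x = ∇ (Ψ t) x) :
    ∀ t ∈ lifespan τ, ∀ x, b t x = a t x ∧ Ψ t x = Φ t x := by
  have hva : ∀ t ∈ lifespan τ, ∇ (Φ t) = v t := fun t ht => funext fun x => (hρa t ht x).2.symm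
  have hvb : ∀ t ∈ lifespan τ, ∇ (Ψ t) = v t := fun t ht => funext fun x => (hρb t ht x).2.symm
  -- Both amplitudes are transported by the same v, so their difference solves the homogeneous
  -- linear equation. The phases then agree because both time derivatives are -B, which depends only
  -- on (ρ, v).
  have hab : ∀ t ∈ lifespan τ, ∀ x, b t x - a t x = 0 := by
    refine transport_eq_zero (u := fun t x => b t x - a t x) (h.exists_curve hτ)
      (h.smooth_half_divergence hτ) (ContDiffOn.sub hb.smooth_amplitude ha.smooth_amplitude)
      (fun t ht h0 x => ?_) (fun x => by simp [ha.initial_amplitude, hb.initial_amplitude])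
    have h1 := ha.transport_eq ht h0 x
    have h2 := hb.transport_eq ht h0 x
    rw [hva t ht] at h1
    rw [hvb t ht] at h2
    rw [((hb.smooth_amplitude.hasDerivAt ht h0 x).fun_sub
        (ha.smooth_amplitude.hasDerivAt ht h0 x)).deriv,
      ((hb.smooth_amplitude.hasFDerivAt ht x).fun_sub (ha.smooth_amplitude.hasFDerivAt ht x)).fderiv,
      sub_apply, smul_sub]
    linear_combination h2 - h1
  refine fun t ht x => ⟨sub_eq_zero.1 (hab t ht x), ?_⟩
  have hconst : ContinuousOn (fun _ : ℝ => x) (Icc 0 t) := continuousOn_const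
  refine sub_eq_zero.1 (eq_zero_of_norm_deriv_le (K := 0) (y' := fun _ => 0)
    (y := fun r => Ψ r x - Φ r x) ht.1 ((hb.smooth_phase.continuousOn_curve ht hconst).sub
      (ha.smooth_phase.continuousOn_curve ht hconst)) (fun r hr => ?_) (by simp)
    (by simp [ha.initial_phase, hb.initial_phase]))
  have hr' := mem_lifespan_of_le ht hr.1.le hr.2.le
  refine ((hb.smooth_phase.hasDerivAt hr' hr.1 x).sub
    (ha.smooth_phase.hasDerivAt hr' hr.1 x)).congr_deriv ?_
  rw [ha.deriv_phase hr' hr.1, hb.deriv_phase hr' hr.1]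
  simp only [bernoulli, hva r hr', hvb r hr', ← (hρa r hr' x).1, ← (hρb r hr' x).1, sub_self]

end Solutions

end Superfluid

end

theorem lemma2p1 {d : ℕ} (hd : d = 2 ∨ d = 3)
    (Ω : ℝ) (hΩ : 0 ≤ Ω)
    (V : Superfluid.Space d → ℝ) (hV : ContDiff ℝ ∞ V)
    (f : ℝ → ℝ) (hf : ContDiff ℝ ∞ f) (hf' : ∀ z, 0 < deriv f z)
    (a₀ : Superfluid.Space d → ℂ) (ha₀ : ContDiff ℝ ∞ a₀)
    (Φ₀ : Superfluid.Space d → ℝ) (hΦ₀ : Superfluid.SubQuadratic Φ₀) :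
    Superfluid.hydroMaxTime Ω V f (fun x => ‖a₀ x‖ ^ 2) (∇ Φ₀)
        = Superfluid.wkbMaxTime Ω V f a₀ Φ₀ ∧
      (∀ τ : ℝ≥0∞, 0 < τ → ∀ (a : ℝ → Superfluid.Space d → ℂ) (Φ : ℝ → Superfluid.Space d → ℝ),
        Superfluid.IsWKBSolution Ω V f a₀ Φ₀ τ a Φ →
          Superfluid.IsHydroSolution Ω V f (fun x => ‖a₀ x‖ ^ 2) (∇ Φ₀) τ
            (fun t x => ‖a t x‖ ^ 2) (fun t => ∇ (Φ t))) ∧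
      (∀ τ : ℝ≥0∞, 0 < τ →
        ∀ (ρ : ℝ → Superfluid.Space d → ℝ) (v : ℝ → Superfluid.Space d → Superfluid.Space d),
        Superfluid.IsHydroSolution Ω V f (fun x => ‖a₀ x‖ ^ 2) (∇ Φ₀) τ ρ v →
          ∃ (a : ℝ → Superfluid.Space d → ℂ) (Φ : ℝ → Superfluid.Space d → ℝ),
            Superfluid.IsWKBSolution Ω V f a₀ Φ₀ τ a Φ ∧
            (∀ t ∈ Superfluid.lifespan τ, ∀ x, ρ t x = ‖a t x‖ ^ 2 ∧ v t x = ∇ (Φ t) x) ∧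
            ∀ (b : ℝ → Superfluid.Space d → ℂ) (Ψ : ℝ → Superfluid.Space d → ℝ),
              Superfluid.IsWKBSolution Ω V f a₀ Φ₀ τ b Ψ →
              (∀ t ∈ Superfluid.lifespan τ, ∀ x, ρ t x = ‖b t x‖ ^ 2 ∧ v t x = ∇ (Ψ t) x) →
              ∀ t ∈ Superfluid.lifespan τ, ∀ x, b t x = a t x ∧ Ψ t x = Φ t x) := by

  refine ⟨?_, fun τ hτ a Φ h => h.isHydroSolution hτ, fun τ hτ ρ v h => ?_⟩
  · refine congrArg sSup (Set.ext fun τ => and_congr_right fun hτ => ⟨?_, ?_⟩)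
    · rintro ⟨ρ, v, h⟩
      obtain ⟨a, Φ, h', -⟩ := h.exists_isWKBSolution hτ hV hf ha₀ hΦ₀.1
      exact ⟨a, Φ, h'⟩
    · rintro ⟨a, Φ, h⟩
      exact ⟨_, _, h.isHydroSolution hτ⟩
  · obtain ⟨a, Φ, h', hρ⟩ := h.exists_isWKBSolution hτ hV hf ha₀ hΦ₀.1
    exact ⟨a, Φ, h', hρ, fun b Ψ hb hρb => h.isWKBSolution_unique hτ h' hρ hb hρb⟩
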